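/- Let $\Gamma$ be a word hyperbolic group whose Gromov boundary $\partial_\infty\Gamma$ properly contains a $2$-sphere, i.e. there is a topological embedding $S^2\to\partial_\infty\Gamma$ that is not surjective. Then for every integer $q\ge 0$ there is no $(2q+1)$-Anosov representation $\rho:\Gamma\to\mathsf{SL}_{4q+2}(\mathbb{C})$. Here, for $1\le k\le d/2$, a homomorphism $\rho:\Gamma\to\mathsf{SL}_d(\mathbb{C})$ is called $k$-Anosov if there exist $c,\mu>0$ such that $$\frac{\sigma_k(\rho(\gamma))}{\sigma_{k+1}(\rho(\gamma))}\ \ge\ c\,e^{\mu|\gamma|_\Gamma}\qquad\text{for all }\gamma\in\Gamma,$$ where $\sigma_1(g)\ge\dots\ge\sigma_d(g)$ are the singular values of $g$ and $|\gamma|_\Gamma$ is the word length of $\gamma$ with respect to a fixed finite generating set of $\Gamma$. -/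

import Mathlib

/-- The left-invariant word metric on `Γ` with respect to `S`: the graph distance in the Cayley
graph, in which `g` is joined to `g * s` for all `s ∈ S`. -/
noncomputable def wordDist {Γ : Type*} [Group Γ] (S : Set Γ) (g h : Γ) : ℕ :=
  (SimpleGraph.mulCayley S).dist g h

/-- The word length `|γ|`: the distance of `γ` from the identity. -/
noncomputable def wordLength {Γ : Type*} [Group Γ] (S : Set Γ) (g : Γ) : ℕ :=
  wordDist S 1 g

/-- The Gromov product `(x | y)_w` in the word metric. -/
noncomputable def gromovProduct {Γ : Type*} [Group Γ] (S : Set Γ) (w x y : Γ) : ℝ :=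
  ((wordDist S w x : ℝ) + wordDist S w y - wordDist S x y) / 2

/-- `Γ` is a word hyperbolic group, as witnessed by the finite generating set `S`: the word metric
of `S` satisfies Gromov's four-point condition for some `δ`. -/
structure IsWordHyperbolic {Γ : Type*} [Group Γ] (S : Set Γ) : Prop where
  finite : S.Finite
  closure_eq_top : Subgroup.closure S = ⊤
  hyperbolic : ∃ δ : ℝ, ∀ w x y z : Γ,
    min (gromovProduct S w x y) (gromovProduct S w y z) - δ ≤ gromovProduct S w x z

/-- Geodesic rays in the Cayley graph of `(Γ, S)` that start at the identity, given by the sequence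
of vertices that they pass at integer times. -/
structure GeodesicRay {Γ : Type*} [Group Γ] (S : Set Γ) where
  toFun : ℕ → Γ
  map_zero : toFun 0 = 1
  dist_eq : ∀ m n : ℕ, wordDist S (toFun m) (toFun (m + n)) = n

/-- The topology of uniform convergence on compact sets. For rays that are given by their vertices
this is pointwise convergence, `Γ` being discrete. -/
instance GeodesicRay.instTopologicalSpace {Γ : Type*} [Group Γ] (S : Set Γ) :
    TopologicalSpace (GeodesicRay S) :=
  TopologicalSpace.induced GeodesicRay.toFun
    (@Pi.topologicalSpace ℕ (fun _ => Γ) (fun _ => ⊥))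

/-- Two rays are asymptotic if they stay at bounded distance from each other. -/
def GeodesicRay.Asymptotic {Γ : Type*} [Group Γ] {S : Set Γ} (r s : GeodesicRay S) : Prop :=
  ∃ C : ℕ, ∀ n : ℕ, wordDist S (r.toFun n) (s.toFun n) ≤ C

theorem GeodesicRay.reachable {Γ : Type*} [Group Γ] {S : Set Γ} (r : GeodesicRay S) (n : ℕ) :
    (SimpleGraph.mulCayley S).Reachable 1 (r.toFun n) := by
  rcases Nat.eq_zero_or_pos n with rfl | hn
  · rw [r.map_zero]
  · have h := r.dist_eq 0 n
    rw [r.map_zero, Nat.zero_add] at h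
    exact SimpleGraph.Reachable.of_dist_ne_zero (by unfold wordDist at h; omega)

theorem GeodesicRay.wordDist_triangle {Γ : Type*} [Group Γ] {S : Set Γ}
    (r s t : GeodesicRay S) (n : ℕ) :
    wordDist S (r.toFun n) (t.toFun n) ≤
      wordDist S (r.toFun n) (s.toFun n) + wordDist S (s.toFun n) (t.toFun n) := by
  obtain ⟨p, hp⟩ := ((r.reachable n).symm.trans (s.reachable n)).exists_walk_length_eq_dist
  obtain ⟨q, hq⟩ := ((s.reachable n).symm.trans (t.reachable n)).exists_walk_length_eq_dist
  unfold wordDist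
  rw [← hp, ← hq, ← SimpleGraph.Walk.length_append]
  exact SimpleGraph.dist_le _

/-- The equivalence relation of being asymptotic. -/
def GeodesicRay.setoid {Γ : Type*} [Group Γ] (S : Set Γ) : Setoid (GeodesicRay S) where
  r := GeodesicRay.Asymptotic
  iseqv :=
    { refl := fun r => ⟨0, fun n => by simp [wordDist]⟩
      symm := fun {r s} ⟨C, h⟩ => ⟨C, fun n => by
        have := h n
        unfold wordDist at this ⊢
        rwa [SimpleGraph.dist_comm]⟩
      trans := fun {r s t} ⟨C, h⟩ ⟨D, k⟩ => ⟨C + D, fun n =>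
        (r.wordDist_triangle s t n).trans (Nat.add_le_add (h n) (k n))⟩ }

/-- The Gromov boundary of `Γ`: asymptotic classes of geodesic rays from the identity. -/
def GromovBoundary {Γ : Type*} [Group Γ] (S : Set Γ) : Type _ :=
  Quotient (GeodesicRay.setoid S)

/-- The topology of the Gromov boundary: the quotient of the topology on the space of rays. -/
instance GromovBoundary.instTopologicalSpace {Γ : Type*} [Group Γ] (S : Set Γ) :
    TopologicalSpace (GromovBoundary S) :=
  inferInstanceAs (TopologicalSpace (Quotient (GeodesicRay.setoid S)))

/-- `X` has a proper subspace homeomorphic to the 2-sphere. -/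
def ProperlyContainsTwoSphere (X : Type*) [TopologicalSpace X] : Prop :=
  ∃ f : Metric.sphere (0 : EuclideanSpace ℝ (Fin 3)) 1 → X,
    Topology.IsEmbedding f ∧ Set.range f ≠ Set.univ

/-- The `i`-th largest singular value `σ_i(g)`, with `i` counted from `1`; Mathlib counts
from `0`. -/
noncomputable def sigma {d : ℕ} (i : ℕ) (g : Matrix (Fin d) (Fin d) ℂ) : ℝ :=
  (Matrix.toEuclideanLin g).singularValues (i - 1)

/-- `ρ : Γ → SL_d(ℂ)` is `k`-Anosov, where `1 ≤ k ≤ d / 2`. -/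
def IsAnosov {Γ : Type*} [Group Γ] (S : Set Γ) {d : ℕ} (k : ℕ)
    (ρ : Γ →* Matrix.SpecialLinearGroup (Fin d) ℂ) : Prop :=
  1 ≤ k ∧ 2 * k ≤ d ∧ ∃ c μ : ℝ, 0 < c ∧ 0 < μ ∧ ∀ γ : Γ,
    c * Real.exp (μ * wordLength S γ) ≤
      sigma k (ρ γ : Matrix (Fin d) (Fin d) ℂ) / sigma (k + 1) (ρ γ : Matrix (Fin d) (Fin d) ℂ)

/-! Put k = 2q + 1 and d = 2k. The exterior product Λ^k × Λ^k → Λ^{2k} = ℂ is a nondegenerate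
`SL_d`-invariant form ω, and it is alternating because k is odd. On Λ^k the gap σ_k / σ_{k+1}
becomes the gap between the two largest singular values (`exists_isDominated_antisymAction`), so
every γ maps Λ^k close to a single line, with relative error exponentially small in |γ|. Along
geodesic rays these lines converge, which gives a continuous map ξ from the boundary to lines of Λ^k
(`exists_boundary_map`).

Distinct boundary points have limit lines that are not ω-orthogonal
(`form_ne_zero_of_not_asymptotic`). Two non-asymptotic rays r, s form a quasi-geodesic, so `R (r
n)⁻¹` contracts the limit line of r and expands that of s at nearly extremal rates
(`exists_norm_mul_norm_limit_le`). Orthogonality would make the expansion of the second line too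
weak, since invariance makes `R g⁻¹` the ω-adjoint of `R g`.

The contradiction is topological (`not_properlyContainsTwoSphere_of_alternating`). Choose z outside
the sphere. Since ω(ξ(z), ·) vanishes on no line ξ(x) with x ≠ z, it trivializes these lines over
the sphere: there is a continuous nonzero section p. Then x ↦ ω(p(x), p(-x)) is continuous and
nowhere zero, and it is odd because ω is alternating, contrary to Borsuk–Ulam. -/

/-! ### The Borsuk–Ulam theorem on the 2-sphere, by lifting to the universal cover of the circle. -/

section BorsukUlam

open Real

/-- Spherical coordinates `(θ, φ) ↦ (sin θ cos φ, sin θ sin φ, cos θ)` on the unit sphere. -/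
noncomputable def sphericalPoint (p : ℝ × ℝ) : Metric.sphere (0 : EuclideanSpace ℝ (Fin 3)) 1 :=
  ⟨!₂[sin p.1 * cos p.2, sin p.1 * sin p.2, cos p.1], by
    rw [mem_sphere_zero_iff_norm, EuclideanSpace.norm_eq, Real.sqrt_eq_one]
    simp only [Fin.sum_univ_three, Real.norm_eq_abs, sq_abs]
    simp
    nlinarith [sin_sq_add_cos_sq p.1, sin_sq_add_cos_sq p.2]⟩

theorem continuous_sphericalPoint : Continuous sphericalPoint := by
  refine Continuous.subtype_mk ?_ _
  refine (PiLp.continuous_toLp 2 _).comp (continuous_pi fun i => ?_)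
  fin_cases i <;> simp <;> fun_prop

theorem sphericalPoint_add_two_pi (θ φ : ℝ) :
    sphericalPoint (θ, φ + 2 * π) = sphericalPoint (θ, φ) := by
  simp [sphericalPoint]

theorem sphericalPoint_zero (φ : ℝ) : sphericalPoint (0, φ) = sphericalPoint (0, 0) := by
  simp [sphericalPoint]

theorem sphericalPoint_equator_add_pi (φ : ℝ) :
    sphericalPoint (π / 2, φ + π) = -sphericalPoint (π / 2, φ) := by
  apply Subtype.ext
  ext i
  fin_cases i <;> simp [sphericalPoint]

/-- The Borsuk–Ulam theorem for maps from the 2-sphere to the circle. -/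
theorem not_continuous_odd_sphere_to_circle
    (f : Metric.sphere (0 : EuclideanSpace ℝ (Fin 3)) 1 → Circle) (hf : Continuous f)
    (hodd : ∀ x, f (-x) = Circle.exp π * f x) : False := by
  obtain ⟨e₀, he₀⟩ := Circle.exp_surjective (f (sphericalPoint 0))
  -- The coordinates (θ, φ) range over the whole plane, which is simply connected, so an angle
  -- function g exists.
  obtain ⟨g, ⟨-, hg⟩, -⟩ := Circle.isCoveringMap_exp.existsUnique_continuousMap_lifts
    ⟨fun p => f (sphericalPoint p), hf.comp continuous_sphericalPoint⟩ 0 e₀ he₀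
  have hg' (p) : Circle.exp (g p) = f (sphericalPoint p) := congrFun hg p
  have hpole (φ : ℝ) : g (0, φ) = g (0, 0) :=
    Circle.isCoveringMap_exp.const_of_comp (g := fun φ : ℝ => g (0, φ)) (by fun_prop)
      (fun a b => by simp only [hg', sphericalPoint_zero a, sphericalPoint_zero b]) _ _
  -- The change of angle over a full turn takes values in one fibre of `Circle.exp`, hence is
  -- constant; it vanishes at the pole θ = 0, where g does not depend on φ.
  have hper (θ φ : ℝ) : g (θ, φ + 2 * π) - g (θ, φ) = 0 := by
    rw [Circle.isCoveringMap_exp.const_of_comp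
      (g := fun p : ℝ × ℝ => g (p.1, p.2 + 2 * π) - g p) (by fun_prop)
      (fun a b => by
        simp only [Circle.exp_sub, hg', sphericalPoint_add_two_pi, div_self']) (θ, φ) (0, 0)]
    simp [hpole]
  have hanti (φ : ℝ) : Circle.exp (g (π / 2, φ + π) - g (π / 2, φ)) = Circle.exp π := by
    simp only [Circle.exp_sub, hg', sphericalPoint_equator_add_pi, hodd, mul_div_cancel_right]
  -- On the equator the change over a half turn is constant too. Two half turns make a full turn, so
  -- it is 0, although oddness requires its exponential to be -1.
  have hconst := Circle.isCoveringMap_exp.const_of_comp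
      (g := fun φ : ℝ => g (π / 2, φ + π) - g (π / 2, φ)) (by fun_prop)
      (fun a b => by simp only [hanti]) 0 (0 + π)
  have h2 := hper (π / 2) 0
  have h3 : g (π / 2, 0 + π) - g (π / 2, 0) = 0 := by
    have : (0 : ℝ) + π + π = 0 + 2 * π := by ring
    simp only [this] at hconst
    linarith
  have h4 := hanti 0
  rw [h3, Circle.exp_zero] at h4
  have h5 := congrArg (fun z : Circle => (z : ℂ)) h4
  simp only [Circle.coe_exp, Complex.exp_pi_mul_I, Circle.coe_one] at h5
  norm_num at h5

/-- The Borsuk–Ulam theorem in dimension 2. -/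
theorem exists_sphere_eq_zero_of_odd
    (f : Metric.sphere (0 : EuclideanSpace ℝ (Fin 3)) 1 → ℂ) (hf : Continuous f)
    (hodd : ∀ x, f (-x) = -f x) : ∃ x, f x = 0 := by
  by_contra! h
  have hmem (x) : f x / ‖f x‖ ∈ Submonoid.unitSphere ℂ :=
    mem_sphere_zero_iff_norm.2 (by simp [h x])
  obtain ⟨F, hF⟩ : ∃ F : Metric.sphere (0 : EuclideanSpace ℝ (Fin 3)) 1 → Circle,
      ∀ x, (F x : ℂ) = f x / ‖f x‖ := ⟨fun x => ⟨_, hmem x⟩, fun x => rfl⟩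
  refine not_continuous_odd_sphere_to_circle F ?_ fun x => ?_
  · refine continuous_induced_rng.2 ?_
    exact (hf.div (g := fun x => (‖f x‖ : ℂ)) (by fun_prop) fun x => by simpa using h x).congr
      fun x => (hF x).symm
  · ext
    rw [Circle.coe_mul, Circle.coe_exp, Complex.exp_pi_mul_I, hF, hF, hodd, norm_neg]
    ring

end BorsukUlam

/-! ### Word metrics, geodesic rays and hyperbolicity. -/

section WordMetric

variable {Γ : Type*} [Group Γ] {S : Set Γ}

theorem wordDist_comm (g h : Γ) : wordDist S g h = wordDist S h g :=
  SimpleGraph.dist_comm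

/-- Left translation as an automorphism of the Cayley graph. -/
def cayleyLeftMul (S : Set Γ) (a : Γ) :
    SimpleGraph.mulCayley S ≃g SimpleGraph.mulCayley S where
  toEquiv := Equiv.mulLeft a
  map_rel_iff' := by simp

theorem wordDist_mul_left (a g h : Γ) : wordDist S (a * g) (a * h) = wordDist S g h := by
  have key (a g h : Γ) (hr : (SimpleGraph.mulCayley S).Reachable g h) :
      wordDist S (a * g) (a * h) ≤ wordDist S g h := by
    obtain ⟨p, hp⟩ := hr.exists_walk_length_eq_dist
    rw [wordDist, wordDist, ← hp, ← SimpleGraph.Walk.length_map (cayleyLeftMul S a).toHom p]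
    exact SimpleGraph.dist_le _
  by_cases hr : (SimpleGraph.mulCayley S).Reachable g h
  · refine (key a g h hr).antisymm ?_
    simpa using key a⁻¹ (a * g) (a * h) (hr.map (cayleyLeftMul S a).toHom)
  · have hr' : ¬ (SimpleGraph.mulCayley S).Reachable (a * g) (a * h) := fun h' => hr <| by
      simpa [cayleyLeftMul] using h'.map (cayleyLeftMul S a⁻¹).toHom
    -- S need not generate here: unreachable pairs have the default distance 0 on both sides.
    rw [wordDist, wordDist, SimpleGraph.dist_eq_zero_of_not_reachable hr,
      SimpleGraph.dist_eq_zero_of_not_reachable hr']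

theorem wordLength_inv_mul (g h : Γ) : wordLength S (g⁻¹ * h) = wordDist S g h := by
  rw [wordLength, ← wordDist_mul_left g, mul_one, mul_inv_cancel_left]

theorem wordLength_inv (g : Γ) : wordLength S g⁻¹ = wordLength S g := by
  rw [← mul_one g⁻¹, wordLength_inv_mul, wordDist_comm, wordLength]

theorem mulCayley_connected (h : Subgroup.closure S = ⊤) :
    (SimpleGraph.mulCayley S).Connected := by
  have key : ∀ g : Γ, (SimpleGraph.mulCayley S).Reachable 1 g := by
    intro g
    have hg : g ∈ Subgroup.closure S := h ▸ Subgroup.mem_top g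
    have step (a s : Γ) (hs : s ∈ S ∨ s⁻¹ ∈ S) :
        (SimpleGraph.mulCayley S).Reachable a (a * s) := by
      by_cases h1 : a = a * s
      · rw [← h1]
      · exact SimpleGraph.Adj.reachable
          ((SimpleGraph.mulCayley_adj S _ _).2 ⟨h1, by simpa using hs⟩)
    induction hg using Subgroup.closure_induction_right with
    | one => rfl
    | mul_right x hx y hy ih => exact ih.trans (step x y (.inl hy))
    | mul_inv_cancel x hx y hy ih => exact ih.trans (step x y⁻¹ (.inr (by simpa using hy)))
  exact ⟨fun g h => (key g).symm.trans (key h)⟩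

theorem wordDist_triangle (h : Subgroup.closure S = ⊤) (x y z : Γ) :
    wordDist S x z ≤ wordDist S x y + wordDist S y z :=
  (mulCayley_connected h).dist_triangle

theorem mem_or_inv_mem_of_wordDist_eq_one {g h : Γ} (hd : wordDist S g h = 1) :
    g⁻¹ * h ∈ S ∨ (g⁻¹ * h)⁻¹ ∈ S := by
  have := ((SimpleGraph.mulCayley_adj S _ _).1 (SimpleGraph.dist_eq_one_iff_adj.1 hd)).2
  simpa using this

/-- A submultiplicative function on a finitely generated group that is at most `K` on the
generators and their inverses grows at most exponentially in the word length. -/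
theorem le_pow_wordLength (h : Subgroup.closure S = ⊤) {ν : Γ → ℝ} {K : ℝ} (hK : 1 ≤ K)
    (h1 : ν 1 ≤ 1) (hpos : ∀ g, 0 ≤ ν g) (hmul : ∀ a b, ν (a * b) ≤ ν a * ν b)
    (hS : ∀ s, s ∈ S ∨ s⁻¹ ∈ S → ν s ≤ K) (g : Γ) : ν g ≤ K ^ wordLength S g := by
  have key : ∀ (a b : Γ) (p : (SimpleGraph.mulCayley S).Walk a b), ν (a⁻¹ * b) ≤ K ^ p.length := by
    intro a b p
    induction p with
    | nil => simpa using h1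
    | @cons a b c hab p ih =>
      have h2 := ((SimpleGraph.mulCayley_adj S _ _).1 hab).2
      have h3 : a⁻¹ * c = (a⁻¹ * b) * (b⁻¹ * c) := by group
      rw [h3, SimpleGraph.Walk.length_cons, pow_succ']
      exact (hmul _ _).trans (mul_le_mul (hS _ (by simpa using h2)) ih (hpos _) (by positivity))
  obtain ⟨p, hp⟩ := ((mulCayley_connected h).preconnected 1 g).exists_walk_length_eq_dist
  have := key 1 g p
  rwa [hp, inv_one, one_mul] at this

theorem GeodesicRay.wordDist_eq (r : GeodesicRay S) {m n : ℕ} (h : m ≤ n) :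
    wordDist S (r.toFun m) (r.toFun n) = n - m := by
  obtain ⟨k, rfl⟩ := Nat.exists_eq_add_of_le h
  rw [r.dist_eq, Nat.add_sub_cancel_left]

theorem GeodesicRay.wordDist_one (r : GeodesicRay S) (n : ℕ) :
    wordDist S 1 (r.toFun n) = n := by
  rw [← r.map_zero, r.wordDist_eq (Nat.zero_le n), Nat.sub_zero]

/-- In a hyperbolic group, the union of two rays that are not asymptotic is a quasi-geodesic. -/
theorem IsWordHyperbolic.exists_le_wordDist_of_not_asymptotic (hS : IsWordHyperbolic S)
    {r s : GeodesicRay S} (hrs : ¬ r.Asymptotic s) :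
    ∃ C : ℕ, ∀ m n : ℕ, m + n ≤ wordDist S (r.toFun m) (s.toFun n) + C := by
  obtain ⟨δ, hδ⟩ := hS.hyperbolic
  by_contra! hC
  -- Failure of the bound for C = 2t yields m, n with (r m | s n) ≥ t. Two uses of the four-point
  -- condition along r t, r m, s n, s t give (r t | s t) ≥ t - 2δ, that is, distance at most 4δ.
  refine hrs ⟨⌈4 * δ⌉₊, fun t => ?_⟩
  obtain ⟨m, n, hmn⟩ := hC (2 * t)
  have tri := wordDist_triangle hS.closure_eq_top
  have hm := tri 1 (r.toFun m) (s.toFun n)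
  have hn := tri 1 (s.toFun n) (r.toFun m)
  rw [wordDist_comm (s.toFun n) (r.toFun m)] at hn
  rw [r.wordDist_one, s.wordDist_one] at hm hn
  have htm : t ≤ m := by omega
  have htn : t ≤ n := by omega
  have e1 : gromovProduct S 1 (r.toFun t) (r.toFun m) = t := by
    rw [gromovProduct, r.wordDist_one, r.wordDist_one, r.wordDist_eq htm]
    push_cast [htm]; ring
  have e2 : gromovProduct S 1 (s.toFun n) (s.toFun t) = t := by
    rw [gromovProduct, s.wordDist_one, s.wordDist_one, wordDist_comm, s.wordDist_eq htn]
    push_cast [htn]; ring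
  have e3 : (t : ℝ) ≤ gromovProduct S 1 (r.toFun m) (s.toFun n) := by
    rw [gromovProduct, r.wordDist_one, s.wordDist_one]
    have : ((wordDist S (r.toFun m) (s.toFun n) + 2 * t : ℕ) : ℝ) < ((m + n : ℕ) : ℝ) := by
      exact_mod_cast hmn
    push_cast at this
    linarith
  have h0 : 0 ≤ δ := by
    have := hδ 1 1 1 1
    simp [gromovProduct] at this
    exact this
  have h1 := hδ 1 (r.toFun t) (r.toFun m) (s.toFun n)
  have h2 := hδ 1 (r.toFun t) (s.toFun n) (s.toFun t)
  rw [e1, min_eq_left e3] at h1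
  rw [e2] at h2
  have h3 : (t : ℝ) - δ ≤ min (gromovProduct S 1 (r.toFun t) (s.toFun n)) t :=
    le_min h1 (by linarith)
  have h4 : (t : ℝ) - 2 * δ ≤ gromovProduct S 1 (r.toFun t) (s.toFun t) := by linarith
  rw [gromovProduct, r.wordDist_one, s.wordDist_one] at h4
  have h5 : (wordDist S (r.toFun t) (s.toFun t) : ℝ) ≤ ⌈4 * δ⌉₊ :=
    le_trans (by linarith) (Nat.le_ceil (4 * δ))
  exact_mod_cast h5

end WordMetric

/-! ### Operators dominated by a line, and dominated sequences. -/

section Dominated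

open Filter Topology InnerProductSpace

variable {H : Type*} [NormedAddCommGroup H] [InnerProductSpace ℂ H]

/-- The orthogonal projection to the line of a unit vector `u`. -/
noncomputable def lineProj (u : H) : H →L[ℂ] H :=
  rankOne ℂ u u

theorem lineProj_apply (u y : H) : lineProj u y = (inner ℂ u y : ℂ) • u := by
  simp [lineProj]

theorem norm_sub_lineProj_sq {u v : H} (hu : ‖u‖ = 1) (hv : ‖v‖ = 1) :
    ‖u - lineProj v u‖ ^ 2 = 1 - ‖(inner ℂ v u : ℂ)‖ ^ 2 := by
  rw [lineProj_apply, @norm_sub_sq ℂ, norm_smul, inner_smul_right, hu, hv, ← inner_conj_symm u v,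
    RCLike.mul_conj]
  norm_cast
  ring

/-- Both sides are the sine of the angle between the two lines. -/
theorem norm_sub_lineProj_comm {u v : H} (hu : ‖u‖ = 1) (hv : ‖v‖ = 1) :
    ‖u - lineProj v u‖ = ‖v - lineProj u v‖ := by
  rw [← sq_eq_sq₀ (norm_nonneg _) (norm_nonneg _), norm_sub_lineProj_sq hu hv,
    norm_sub_lineProj_sq hv hu, norm_inner_symm]

theorem norm_lineProj_sub_lineProj_le {u v : H} (hu : ‖u‖ = 1) (hv : ‖v‖ = 1) :
    ‖lineProj u - lineProj v‖ ≤ 2 * ‖v - lineProj u v‖ := by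
  refine ContinuousLinearMap.opNorm_le_bound _ (by positivity) fun y => ?_
  have h : (lineProj u - lineProj v) y = (inner ℂ (u - lineProj v u) y : ℂ) • u
      - (inner ℂ v y : ℂ) • (v - lineProj u v) := by
    simp only [lineProj_apply, inner_sub_left, inner_smul_left, sub_apply,
      inner_conj_symm, sub_smul, smul_sub, smul_smul]
    rw [mul_comm (inner ℂ u v : ℂ)]
    abel
  rw [h]
  refine (norm_sub_le _ _).trans ?_
  rw [norm_smul, norm_smul, hu]
  have h1 := norm_inner_le_norm (𝕜 := ℂ) (u - lineProj v u) y
  have h2 := norm_inner_le_norm (𝕜 := ℂ) v y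
  rw [norm_sub_lineProj_comm hu hv] at h1
  rw [hv, one_mul] at h2
  have h3 := mul_le_mul_of_nonneg_right h2 (norm_nonneg (v - lineProj u v))
  linarith

/-- `T` expands the line of some vector to the line of the unit vector `u` with factor `‖T‖`, and
maps everything into a neighbourhood of relative size `ε` of that line. -/
structure IsDominated (T : H →L[ℂ] H) (u : H) (ε : ℝ) : Prop where
  norm_eq : ‖u‖ = 1
  exists_preimage : ∃ x, T x = u ∧ ‖T‖ * ‖x‖ ≤ 1
  norm_sub_le : ∀ y, ‖T y - lineProj u (T y)‖ ≤ ε * ‖T‖ * ‖y‖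

theorem IsDominated.norm_pos {T : H →L[ℂ] H} {u : H} {ε : ℝ} (h : IsDominated T u ε) :
    0 < ‖T‖ := by
  refine norm_pos_iff.2 fun h0 => ?_
  obtain ⟨x, hx, -⟩ := h.exists_preimage
  have := h.norm_eq
  rw [← hx, h0] at this
  simp at this

theorem IsDominated.nonneg {T : H →L[ℂ] H} {u : H} {ε : ℝ} (h : IsDominated T u ε) :
    0 ≤ ε := by
  have h1 := (norm_nonneg _).trans (h.norm_sub_le u)
  rw [h.norm_eq, mul_one] at h1
  exact nonneg_of_mul_nonneg_left h1 h.norm_pos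

/-- The operator norm is almost multiplicative here: T sends everything near the line of u, and w
nearly spans that line, so A stretches the image of T hardly more than it stretches w. The lower
bound on `‖A w‖` turns additive errors into relative ones, whence `K ^ 2`. -/
theorem IsDominated.norm_comp_mul_le {T A : H →L[ℂ] H} {u w : H} {ε η K : ℝ}
    (h : IsDominated T u ε) (hA : ‖A‖ ≤ K) (hAw : ‖w‖ ≤ K * ‖A w‖)
    (hw : ‖w - lineProj u w‖ ≤ η * ‖w‖) :
    ‖A * T‖ * ‖w‖ ≤ ‖T‖ * ‖A w‖ * (1 + K ^ 2 * (η + ε)) := by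
  have hK : 0 ≤ K := (norm_nonneg _).trans hA
  have hε := h.nonneg
  rcases eq_or_ne w 0 with rfl | hw0
  · simp
  have hwpos : 0 < ‖w‖ := norm_pos_iff.2 hw0
  have hη : 0 ≤ η := nonneg_of_mul_nonneg_left ((norm_nonneg _).trans hw) hwpos
  -- `u` is close to the line of `w`
  have hu : ‖A u‖ * ‖w‖ ≤ ‖A w‖ * (1 + K ^ 2 * η) := by
    set z : H := ((‖w‖⁻¹ : ℝ) : ℂ) • w with hz
    have hz1 : ‖z‖ = 1 := by
      rw [hz, norm_smul]; simp [hw0]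
    have hzw : ‖A z‖ * ‖w‖ = ‖A w‖ := by
      rw [hz, map_smul, norm_smul]
      simp
      field_simp
    have hzu : ‖z - lineProj u z‖ ≤ η := by
      rw [hz, map_smul, ← smul_sub, norm_smul]
      simp only [Complex.norm_real, norm_inv, norm_norm]
      rw [inv_mul_le_iff₀ hwpos]; linarith
    rw [← norm_sub_lineProj_comm h.norm_eq hz1] at hzu
    have e : A u = A (lineProj z u) + A (u - lineProj z u) := by rw [← map_add]; congr 1; abel
    have b1 : ‖A (lineProj z u)‖ ≤ ‖A z‖ := by
      rw [lineProj_apply, map_smul, norm_smul]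
      refine mul_le_of_le_one_left (norm_nonneg _) ?_
      simpa [hz1, h.norm_eq] using norm_inner_le_norm (𝕜 := ℂ) z u
    have b2 : ‖A (u - lineProj z u)‖ ≤ K * η :=
      (A.le_opNorm _).trans (mul_le_mul hA hzu (norm_nonneg _) hK)
    have b3 : ‖A u‖ ≤ ‖A z‖ + K * η := by
      rw [e]; exact (norm_add_le _ _).trans (add_le_add b1 b2)
    calc ‖A u‖ * ‖w‖ ≤ (‖A z‖ + K * η) * ‖w‖ := by gcongr
      _ = ‖A w‖ + K * η * ‖w‖ := by rw [add_mul, hzw]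
      _ ≤ ‖A w‖ + K * η * (K * ‖A w‖) := by gcongr
      _ = _ := by ring
  rw [← le_div_iff₀ hwpos]
  refine ContinuousLinearMap.opNorm_le_bound _ (by positivity) fun y => ?_
  rw [div_mul_eq_mul_div, le_div_iff₀ hwpos, mul_apply_eq_comp]
  have e : A (T y) = A (lineProj u (T y)) + A (T y - lineProj u (T y)) := by
    rw [← map_add]; congr 1; abel
  have b1 : ‖A (lineProj u (T y))‖ ≤ ‖T‖ * ‖y‖ * ‖A u‖ := by
    rw [lineProj_apply, map_smul, norm_smul]
    refine mul_le_mul_of_nonneg_right ?_ (norm_nonneg _)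
    have := norm_inner_le_norm (𝕜 := ℂ) u (T y)
    rw [h.norm_eq, one_mul] at this
    exact this.trans (T.le_opNorm y)
  have b2 : ‖A (T y - lineProj u (T y))‖ ≤ K * (ε * ‖T‖ * ‖y‖) :=
    (A.le_opNorm _).trans (mul_le_mul hA (h.norm_sub_le y) (norm_nonneg _) hK)
  have b3 : ‖A (T y)‖ ≤ ‖T‖ * ‖y‖ * ‖A u‖ + K * (ε * ‖T‖ * ‖y‖) := by
    rw [e]; exact (norm_add_le _ _).trans (add_le_add b1 b2)
  calc ‖A (T y)‖ * ‖w‖ ≤ (‖T‖ * ‖y‖ * ‖A u‖ + K * (ε * ‖T‖ * ‖y‖)) * ‖w‖ := by gcongr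
    _ = ‖T‖ * ‖y‖ * (‖A u‖ * ‖w‖) + K * (ε * ‖T‖ * ‖y‖) * ‖w‖ := by ring
    _ ≤ ‖T‖ * ‖y‖ * (‖A w‖ * (1 + K ^ 2 * η)) + K * (ε * ‖T‖ * ‖y‖) * (K * ‖A w‖) := by
      gcongr
    _ = _ := by ring

variable {Γ : Type*} [Group Γ] {R : Γ →* (H →L[ℂ] H)} {u : Γ → H} {ε : Γ → ℝ}

theorem norm_map_mul_le (R : Γ →* (H →L[ℂ] H)) (a b : Γ) : ‖R (a * b)‖ ≤ ‖R a‖ * ‖R b‖ := by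
  rw [map_mul]; exact norm_mul_le _ _

/-- The vector `u (g * h)` lies in the range of `R g`, so domination puts it near the line of `u g`;
passing from g to gh costs the condition number of `R h`. -/
theorem norm_lineProj_mul_sub_le (hR : ∀ γ, IsDominated (R γ) (u γ) (ε γ)) (g h : Γ) :
    ‖lineProj (u g) - lineProj (u (g * h))‖ ≤ 2 * (ε g * (‖R h‖ * ‖R h⁻¹‖)) := by
  refine (norm_lineProj_sub_lineProj_le (hR g).norm_eq (hR (g * h)).norm_eq).trans ?_
  gcongr
  obtain ⟨x, hx, hx1⟩ := (hR (g * h)).exists_preimage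
  have h1 : u (g * h) = R g (R h x) := by rw [← hx, map_mul]; rfl
  have h2 := (hR g).norm_sub_le (R h x)
  rw [← h1] at h2
  have h3 : ‖R g‖ ≤ ‖R (g * h)‖ * ‖R h⁻¹‖ := by
    simpa using norm_map_mul_le R (g * h) h⁻¹
  have h4 := (R h).le_opNorm x
  have hε := (hR g).nonneg
  calc _ ≤ ε g * ‖R g‖ * ‖R h x‖ := h2
    _ ≤ ε g * (‖R (g * h)‖ * ‖R h⁻¹‖) * (‖R h‖ * ‖x‖) := by gcongr
    _ = ε g * (‖R h‖ * ‖R h⁻¹‖) * (‖R (g * h)‖ * ‖x‖) := by ring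
    _ ≤ ε g * (‖R h‖ * ‖R h⁻¹‖) * 1 := by gcongr
    _ = _ := mul_one _

/-- A short preimage x of `u (a * g)` under `R (a * g)` satisfies `R a⁻¹ (u (a * g)) = R g x`, to
which domination of `R g` applies. -/
theorem norm_map_inv_sub_lineProj_le (hR : ∀ γ, IsDominated (R γ) (u γ) (ε γ)) (a g : Γ) :
    ‖R a⁻¹ (u (a * g)) - lineProj (u g) (R a⁻¹ (u (a * g)))‖ ≤ ε g * ‖R a⁻¹‖ := by
  obtain ⟨x, hx, hx1⟩ := (hR (a * g)).exists_preimage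
  have h1 : R a⁻¹ (u (a * g)) = R g x := by
    rw [← hx, ← mul_apply_eq_comp, ← map_mul, inv_mul_cancel_left]
  rw [h1]
  have h3 : ‖R g‖ ≤ ‖R a⁻¹‖ * ‖R (a * g)‖ := by
    simpa using norm_map_mul_le R a⁻¹ (a * g)
  have hε := (hR g).nonneg
  calc _ ≤ ε g * ‖R g‖ * ‖x‖ := (hR g).norm_sub_le x
    _ ≤ ε g * (‖R a⁻¹‖ * ‖R (a * g)‖) * ‖x‖ := by gcongr
    _ = ε g * ‖R a⁻¹‖ * (‖R (a * g)‖ * ‖x‖) := by ring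
    _ ≤ ε g * ‖R a⁻¹‖ * 1 := by gcongr
    _ = _ := mul_one _

/-- Equivariance of limit lines. -/
theorem limit_lineProj_map_inv (hR : ∀ γ, IsDominated (R γ) (u γ) (ε γ)) {a : Γ} {y : ℕ → Γ}
    {Q Q' : H →L[ℂ] H} (hQ : Tendsto (fun m => lineProj (u (a * y m))) atTop (𝓝 Q))
    (hQ' : Tendsto (fun m => lineProj (u (y m))) atTop (𝓝 Q'))
    (hε : Tendsto (fun m => ε (y m)) atTop (𝓝 0)) {v : H} (hv : Q v = v) :
    Q' (R a⁻¹ v) = R a⁻¹ v := by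
  have hlim : Tendsto (fun m => (1 - lineProj (u (y m))) (R a⁻¹ (lineProj (u (a * y m)) v)))
      atTop (𝓝 ((1 - Q') (R a⁻¹ (Q v)))) := by
    have happ := isBoundedBilinearMap_apply (𝕜 := ℂ) (E := H) (F := H) |>.continuous
    have e1 := (happ.tendsto (Q, v)).comp (hQ.prodMk_nhds tendsto_const_nhds)
    have e2 := ((R a⁻¹).continuous.tendsto _).comp e1
    exact (happ.tendsto (1 - Q', _)).comp ((hQ'.const_sub 1).prodMk_nhds e2)
  have hzero : Tendsto (fun m => (1 - lineProj (u (y m))) (R a⁻¹ (lineProj (u (a * y m)) v)))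
      atTop (𝓝 0) := by
    refine squeeze_zero_norm (a := fun m => ‖v‖ * (ε (y m) * ‖R a⁻¹‖)) (fun m => ?_) ?_
    · rw [lineProj_apply, map_smul, map_smul, norm_smul]
      refine mul_le_mul ?_ ?_ (norm_nonneg _) (norm_nonneg _)
      · simpa [(hR (a * y m)).norm_eq] using norm_inner_le_norm (𝕜 := ℂ) (u (a * y m)) v
      · simpa using norm_map_inv_sub_lineProj_le hR a (y m)
    · simpa using (hε.mul_const ‖R a⁻¹‖).const_mul ‖v‖
  have := tendsto_nhds_unique hlim hzero
  rw [hv, sub_apply, one_apply_eq_self, sub_eq_zero] at this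
  exact this.symm

/-- A sequence in `Γ` along which the representation is uniformly dominated. -/
structure IsDominatedSeq (R : Γ →* (H →L[ℂ] H)) (ε : Γ → ℝ) (C θ K : ℝ) (x : ℕ → Γ) : Prop where
  eps_le : ∀ i n, ε ((x i)⁻¹ * x (i + n)) ≤ C * θ ^ n
  norm_succ_le : ∀ i, ‖R ((x i)⁻¹ * x (i + 1))‖ ≤ K
  norm_succ_inv_le : ∀ i, ‖R ((x (i + 1))⁻¹ * x i)‖ ≤ K

theorem IsDominatedSeq.dist_le (hR : ∀ γ, IsDominated (R γ) (u γ) (ε γ)) {C θ K : ℝ}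
    {x : ℕ → Γ} (hx : IsDominatedSeq R ε C θ K x) (i n : ℕ) :
    dist (lineProj (u ((x i)⁻¹ * x (i + n)))) (lineProj (u ((x i)⁻¹ * x (i + (n + 1)))))
      ≤ 2 * C * K ^ 2 * θ ^ n := by
  have h := norm_lineProj_mul_sub_le hR ((x i)⁻¹ * x (i + n)) ((x (i + n))⁻¹ * x (i + n + 1))
  rw [show (x i)⁻¹ * x (i + n) * ((x (i + n))⁻¹ * x (i + n + 1)) = (x i)⁻¹ * x (i + (n + 1)) by
    rw [mul_assoc, mul_inv_cancel_left, add_assoc]] at h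
  rw [dist_eq_norm]
  refine h.trans ?_
  have h1 := hx.norm_succ_le (i + n)
  have h2 := hx.norm_succ_inv_le (i + n)
  have h3 : ((x (i + n))⁻¹ * x (i + n + 1))⁻¹ = (x (i + n + 1))⁻¹ * x (i + n) := by group
  rw [h3]
  have hK : 0 ≤ K := (norm_nonneg _).trans h1
  have h4 := hx.eps_le i n
  have h5 : 0 ≤ C * θ ^ n := (hR _).nonneg.trans h4
  calc _ ≤ 2 * (C * θ ^ n * (K * K)) := by gcongr
    _ = _ := by ring

theorem IsDominatedSeq.exists_tendsto [CompleteSpace H]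
    (hR : ∀ γ, IsDominated (R γ) (u γ) (ε γ)) {C θ K : ℝ} (hθ : θ < 1)
    {x : ℕ → Γ} (hx : IsDominatedSeq R ε C θ K x) (i : ℕ) :
    ∃ Q, Tendsto (fun n => lineProj (u ((x i)⁻¹ * x (i + n)))) atTop (𝓝 Q) ∧
      ∀ n, ‖lineProj (u ((x i)⁻¹ * x (i + n))) - Q‖ ≤ 2 * C * K ^ 2 * θ ^ n / (1 - θ) := by
  obtain ⟨Q, hQ⟩ := cauchySeq_tendsto_of_complete
    (cauchySeq_of_le_geometric θ (2 * C * K ^ 2) hθ (hx.dist_le hR i))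
  refine ⟨Q, hQ, fun n => ?_⟩
  rw [← dist_eq_norm]
  exact dist_le_of_le_geometric_of_tendsto θ _ hθ (hx.dist_le hR i) hQ n

theorem prod_one_add_mul_pow_le {D θ : ℝ} (hD : 0 ≤ D) (h0 : 0 ≤ θ) (hθ : θ < 1) (n : ℕ) :
    ∏ l ∈ Finset.range n, (1 + D * θ ^ l) ≤ Real.exp (D / (1 - θ)) := by
  calc ∏ l ∈ Finset.range n, (1 + D * θ ^ l) ≤ ∏ l ∈ Finset.range n, Real.exp (D * θ ^ l) := by
        refine Finset.prod_le_prod (fun l _ => by positivity) fun l _ => ?_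
        rw [add_comm]; exact Real.add_one_le_exp _
    _ = Real.exp (D * ∑ l ∈ Finset.range n, θ ^ l) := by rw [← Real.exp_sum, Finset.mul_sum]
    _ ≤ Real.exp (D / (1 - θ)) := by
        rw [div_eq_mul_inv, ← tsum_geometric_of_lt_one h0 hθ]
        gcongr
        exact (summable_geometric_of_lt_one h0 hθ).sum_le_tsum _ fun i _ => by positivity

/-- Vectors on the limit line of a dominated sequence are contracted with the optimal factor. -/
theorem exists_norm_mul_norm_limit_le [CompleteSpace H]
    (hR : ∀ γ, IsDominated (R γ) (u γ) (ε γ)) {C θ K : ℝ} (hC : 0 ≤ C) (h0 : 0 ≤ θ) (hθ : θ < 1) :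
    ∃ M : ℝ, 0 < M ∧ ∀ x : ℕ → Γ, IsDominatedSeq R ε C θ K x → ∀ Q : H →L[ℂ] H,
      Tendsto (fun n => lineProj (u ((x 0)⁻¹ * x n))) atTop (𝓝 Q) → ∀ v, Q v = v → ∀ m,
        ‖R ((x 0)⁻¹ * x m)‖ * ‖R ((x m)⁻¹ * x 0) v‖ ≤ M * ‖v‖ := by
  have h1θ : 0 < 1 - θ := by linarith
  -- D collects the two errors of `IsDominated.norm_comp_mul_le`: η from the distance to the limit
  -- line, and ε from the domination itself.
  set D : ℝ := K ^ 2 * (2 * C * K ^ 2 / (1 - θ) + C) with hD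
  have hD0 : 0 ≤ D := by positivity
  refine ⟨Real.exp (D / (1 - θ)), Real.exp_pos _, fun x hx Q hQ v hv m => ?_⟩
  -- By equivariance, v transported to the base point `x i` lies on the limit line seen from there,
  -- hence exponentially close to the approximating lines.
  have hinv (i : ℕ) (n : ℕ) : ‖R ((x i)⁻¹ * x 0) v
      - lineProj (u ((x i)⁻¹ * x (i + n))) (R ((x i)⁻¹ * x 0) v)‖
      ≤ 2 * C * K ^ 2 * θ ^ n / (1 - θ) * ‖R ((x i)⁻¹ * x 0) v‖ := by
    obtain ⟨Q', hQ', hQ'b⟩ := hx.exists_tendsto hR hθ i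
    have hfix : Q' (R ((x i)⁻¹ * x 0) v) = R ((x i)⁻¹ * x 0) v := by
      have h1 : ((x 0)⁻¹ * x i)⁻¹ = (x i)⁻¹ * x 0 := by group
      rw [← h1]
      refine limit_lineProj_map_inv hR (y := fun n => (x i)⁻¹ * x (i + n)) (Q := Q) ?_ hQ' ?_ hv
      · have := hQ.comp (tendsto_add_atTop_nat i)
        refine this.congr fun n => ?_
        simp only [Function.comp]
        rw [mul_assoc, mul_inv_cancel_left, add_comm]
      · refine squeeze_zero (fun n => (hR _).nonneg) (hx.eps_le i) ?_
        simpa using (tendsto_pow_atTop_nhds_zero_of_lt_one h0 hθ).const_mul C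
    have h2 : R ((x i)⁻¹ * x 0) v - lineProj (u ((x i)⁻¹ * x (i + n))) (R ((x i)⁻¹ * x 0) v)
        = -((lineProj (u ((x i)⁻¹ * x (i + n))) - Q') (R ((x i)⁻¹ * x 0) v)) := by
      rw [sub_apply, hfix]; abel
    rw [h2, norm_neg]
    exact (ContinuousLinearMap.le_opNorm _ _).trans (by gcongr; exact hQ'b n)
  -- Induction backwards from m: the step at distance j from the end loses a factor `1 + D * θ ^ j`.
  -- The product of these factors is bounded independently of m.
  have key : ∀ j ≤ m, ‖R ((x (m - j))⁻¹ * x m)‖ * ‖R ((x m)⁻¹ * x 0) v‖ ≤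
      ‖R ((x (m - j))⁻¹ * x 0) v‖ * ∏ l ∈ Finset.range j, (1 + D * θ ^ l) := by
    intro j
    induction j with
    | zero =>
      intro _
      simp only [Nat.sub_zero, inv_mul_cancel, map_one, Finset.range_zero, Finset.prod_empty,
        mul_one]
      exact mul_le_of_le_one_left (norm_nonneg _) ContinuousLinearMap.norm_id_le
    | succ j ih =>
      intro hj
      have ih := ih (by omega)
      obtain ⟨i, hi⟩ : ∃ i, m = i + 1 + j := ⟨m - (j + 1), by omega⟩
      have e1 : m - j = i + 1 := by omega
      have e2 : m - (j + 1) = i := by omega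
      rw [e1] at ih
      rw [e2]
      have hK1 := hx.norm_succ_le i
      have hK2 := hx.norm_succ_inv_le i
      have hw1 : R ((x i)⁻¹ * x (i + 1)) (R ((x (i + 1))⁻¹ * x 0) v) = R ((x i)⁻¹ * x 0) v := by
        rw [← mul_apply_eq_comp, ← map_mul, mul_assoc, mul_inv_cancel_left]
      have hw2 : R ((x (i + 1))⁻¹ * x i) (R ((x i)⁻¹ * x 0) v) = R ((x (i + 1))⁻¹ * x 0) v := by
        rw [← mul_apply_eq_comp, ← map_mul, mul_assoc, mul_inv_cancel_left]
      have hAw : ‖R ((x (i + 1))⁻¹ * x 0) v‖ ≤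
          K * ‖R ((x i)⁻¹ * x (i + 1)) (R ((x (i + 1))⁻¹ * x 0) v)‖ := by
        rw [hw1]
        conv_lhs => rw [← hw2]
        exact (ContinuousLinearMap.le_opNorm _ _).trans (by gcongr)
      have hstep := (hR ((x (i + 1))⁻¹ * x (i + 1 + j))).norm_comp_mul_le hK1 hAw (hinv (i + 1) j)
      rw [← map_mul, hw1, mul_assoc, mul_inv_cancel_left, ← hi] at hstep
      have hfac : 1 + K ^ 2 * (2 * C * K ^ 2 * θ ^ j / (1 - θ) + ε ((x (i + 1))⁻¹ * x m))
          ≤ 1 + D * θ ^ j := by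
        have := hx.eps_le (i + 1) j
        rw [← hi] at this
        calc _ ≤ 1 + K ^ 2 * (2 * C * K ^ 2 * θ ^ j / (1 - θ) + C * θ ^ j) := by gcongr
          _ = _ := by rw [hD]; ring
      set w := ‖R ((x (i + 1))⁻¹ * x 0) v‖ with hw
      rcases (norm_nonneg (R ((x (i + 1))⁻¹ * x 0) v)).eq_or_lt with hz | hpos
      · have hv0 : R ((x m)⁻¹ * x 0) v = 0 := by
          have : (x m)⁻¹ * x 0 = (x m)⁻¹ * x (i + 1) * ((x (i + 1))⁻¹ * x 0) := by group
          rw [this, map_mul, mul_apply_eq_comp, norm_eq_zero.1 hz.symm, map_zero]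
        rw [hv0, norm_zero, mul_zero]
        refine mul_nonneg (norm_nonneg _) (Finset.prod_nonneg fun l _ => by positivity)
      · rw [Finset.prod_range_succ, ← mul_le_mul_iff_of_pos_right hpos]
        have hP : 0 ≤ ∏ l ∈ Finset.range j, (1 + D * θ ^ l) :=
          Finset.prod_nonneg fun l _ => by positivity
        calc ‖R ((x i)⁻¹ * x m)‖ * ‖R ((x m)⁻¹ * x 0) v‖ * w
            = (‖R ((x i)⁻¹ * x m)‖ * w) * ‖R ((x m)⁻¹ * x 0) v‖ := by ring
          _ ≤ (‖R ((x (i + 1))⁻¹ * x m)‖ * ‖R ((x i)⁻¹ * x 0) v‖ * (1 + D * θ ^ j))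
              * ‖R ((x m)⁻¹ * x 0) v‖ := by
            refine mul_le_mul_of_nonneg_right (hstep.trans ?_) (norm_nonneg _)
            gcongr
          _ = (‖R ((x (i + 1))⁻¹ * x m)‖ * ‖R ((x m)⁻¹ * x 0) v‖) *
              (‖R ((x i)⁻¹ * x 0) v‖ * (1 + D * θ ^ j)) := by ring
          _ ≤ (w * ∏ l ∈ Finset.range j, (1 + D * θ ^ l)) *
              (‖R ((x i)⁻¹ * x 0) v‖ * (1 + D * θ ^ j)) := by gcongr
          _ = _ := by ring
  have h := key m le_rfl
  rw [Nat.sub_self, inv_mul_cancel, map_one, one_apply_eq_self] at h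
  rw [mul_comm _ ‖v‖]
  exact h.trans (by gcongr; exact prod_one_add_mul_pow_le hD0 h0 hθ m)

end Dominated

/-! ### Transversality of limit lines. -/

section LimitMap

open Filter Topology InnerProductSpace

variable {H : Type*} [NormedAddCommGroup H] [InnerProductSpace ℂ H]
  {Γ : Type*} [Group Γ] {S : Set Γ} {R : Γ →* (H →L[ℂ] H)} {u : Γ → H} {ε : Γ → ℝ}

theorem exists_norm_le_of_generators (hS : S.Finite) (R : Γ →* (H →L[ℂ] H)) :
    ∃ K : ℝ, 1 ≤ K ∧ ∀ s, s ∈ S ∨ s⁻¹ ∈ S → ‖R s‖ ≤ K := by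
  obtain ⟨K, hK⟩ := ((hS.union hS.inv).image fun s => ‖R s‖).bddAbove
  refine ⟨max 1 K, le_max_left _ _, fun s hs => le_max_of_le_right (hK ⟨s, ?_, rfl⟩)⟩
  simpa using hs

/-- The representation is uniformly dominated along quasi-geodesics. -/
theorem isDominatedSeq_of_quasiGeodesic {C θ K : ℝ} (hC : 0 ≤ C) (h0 : 0 < θ) (hθ : θ < 1)
    (hε : ∀ γ, ε γ ≤ C * θ ^ wordLength S γ) (hK : ∀ s, s ∈ S ∨ s⁻¹ ∈ S → ‖R s‖ ≤ K)
    {x : ℕ → Γ} {D : ℕ} (hx1 : ∀ i, wordDist S (x i) (x (i + 1)) = 1)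
    (hx : ∀ i n, n ≤ wordDist S (x i) (x (i + n)) + D) :
    IsDominatedSeq R ε (C / θ ^ D) θ K x where
  eps_le i n := by
    refine (hε _).trans ?_
    -- The additive defect D of the quasi-geodesic costs at most the factor θ^{-D}.
    rw [wordLength_inv_mul, div_mul_eq_mul_div, mul_div_assoc]
    gcongr
    rw [le_div_iff₀ (by positivity), ← pow_add]
    exact pow_le_pow_of_le_one h0.le hθ.le (hx i n)
  norm_succ_le i := hK _ (mem_or_inv_mem_of_wordDist_eq_one (hx1 i))
  norm_succ_inv_le i := hK _ (mem_or_inv_mem_of_wordDist_eq_one (by rw [wordDist_comm, hx1 i]))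

theorem GeodesicRay.isDominatedSeq {C θ K : ℝ} (hC : 0 ≤ C) (h0 : 0 < θ) (hθ : θ < 1)
    (hε : ∀ γ, ε γ ≤ C * θ ^ wordLength S γ) (hK : ∀ s, s ∈ S ∨ s⁻¹ ∈ S → ‖R s‖ ≤ K)
    (r : GeodesicRay S) : IsDominatedSeq R ε C θ K r.toFun := by
  simpa using isDominatedSeq_of_quasiGeodesic (D := 0) hC h0 hθ hε hK (fun i => r.dist_eq i 1)
    (fun i n => by rw [r.dist_eq, add_zero])

/-- The concatenation of the initial segment of length `n` of `r`, traversed backwards, with the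
ray `s`. -/
def GeodesicRay.concat (r s : GeodesicRay S) (n i : ℕ) : Γ :=
  if i ≤ n then r.toFun (n - i) else s.toFun (i - n)

theorem GeodesicRay.concat_zero (r s : GeodesicRay S) (n : ℕ) :
    r.concat s n 0 = r.toFun n := by
  simp [GeodesicRay.concat]

theorem GeodesicRay.concat_add (r s : GeodesicRay S) (n i : ℕ) :
    r.concat s n (n + i) = s.toFun i := by
  rcases Nat.eq_zero_or_pos i with rfl | hi
  · simp [GeodesicRay.concat, r.map_zero, s.map_zero]
  · simp [GeodesicRay.concat, hi.ne']

theorem GeodesicRay.concat_self (r s : GeodesicRay S) (n : ℕ) : r.concat s n n = 1 := by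
  simp [GeodesicRay.concat, r.map_zero]

theorem GeodesicRay.concat_wordDist_succ (r s : GeodesicRay S) (n i : ℕ) :
    wordDist S (r.concat s n i) (r.concat s n (i + 1)) = 1 := by
  rcases lt_or_ge i n with h | h
  · rw [GeodesicRay.concat, GeodesicRay.concat, if_pos h.le,
      if_pos (Nat.succ_le_of_lt h), wordDist_comm,
      r.wordDist_eq (by omega)]
    omega
  · obtain ⟨j, rfl⟩ := Nat.exists_eq_add_of_le h
    rw [add_assoc, r.concat_add, r.concat_add, s.dist_eq]

/-- Only pairs on opposite sides of the identity need h. The defect D does not depend on n, so all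
later constants are uniform in n. -/
theorem GeodesicRay.le_concat_wordDist {r s : GeodesicRay S} {D : ℕ}
    (h : ∀ m n, m + n ≤ wordDist S (r.toFun m) (s.toFun n) + D) (n i t : ℕ) :
    t ≤ wordDist S (r.concat s n i) (r.concat s n (i + t)) + D := by
  rcases le_total i n with hi | hi
  · rcases le_total (i + t) n with hj | hj
    · rw [GeodesicRay.concat, GeodesicRay.concat, if_pos hi, if_pos hj, wordDist_comm,
        r.wordDist_eq (by omega)]
      omega
    · obtain ⟨j, hj⟩ := Nat.exists_eq_add_of_le hj
      rw [hj, r.concat_add, GeodesicRay.concat, if_pos hi]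
      have := h (n - i) j
      omega
  · obtain ⟨j, rfl⟩ := Nat.exists_eq_add_of_le hi
    rw [add_assoc, r.concat_add, r.concat_add, s.dist_eq]
    omega

/-- The limit lines of non-asymptotic rays are not orthogonal for an invariant nondegenerate
form. -/
theorem form_ne_zero_of_not_asymptotic [CompleteSpace H] (hS : IsWordHyperbolic S)
    (hR : ∀ γ, IsDominated (R γ) (u γ) (ε γ)) {C θ : ℝ} (hC : 0 ≤ C) (h0 : 0 < θ) (hθ : θ < 1)
    (hε : ∀ γ, ε γ ≤ C * θ ^ wordLength S γ)
    {ω : H →L[ℂ] H →L[ℂ] ℂ} (hω : ∀ γ x y, ω (R γ x) (R γ y) = ω x y)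
    {b : ℝ} (hb : 0 < b) (hnd : ∀ w, b * ‖w‖ ≤ ‖ω w‖)
    {r s : GeodesicRay S} (hrs : ¬ r.Asymptotic s) {P Q : H →L[ℂ] H}
    (hP : Tendsto (fun n => lineProj (u (r.toFun n))) atTop (𝓝 P))
    (hQ : Tendsto (fun n => lineProj (u (s.toFun n))) atTop (𝓝 Q))
    {v w : H} (hv : P v = v) (hw : Q w = w) (hv0 : v ≠ 0) (hw0 : w ≠ 0) : ω w v ≠ 0 := by
  intro hωwv
  obtain ⟨K, hK1, hK⟩ := exists_norm_le_of_generators hS.finite R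
  obtain ⟨D, hD⟩ := hS.exists_le_wordDist_of_not_asymptotic hrs
  obtain ⟨M, hM0, hM⟩ := exists_norm_mul_norm_limit_le (K := K) hR hC h0.le hθ
  obtain ⟨N, hN0, hN⟩ := exists_norm_mul_norm_limit_le (K := K) (C := C / θ ^ D) hR
    (by positivity) h0.le hθ
  have hv1 : 0 < ‖v‖ := norm_pos_iff.2 hv0
  have hw1 : 0 < ‖w‖ := norm_pos_iff.2 hw0
  -- both lines are contracted optimally by `R (r n)⁻¹`
  have hcv (n : ℕ) : ‖R (r.toFun n)‖ * ‖R (r.toFun n)⁻¹ v‖ ≤ M * ‖v‖ := by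
    have := hM r.toFun (r.isDominatedSeq hC h0 hθ hε hK) P (by simpa [r.map_zero] using hP) v hv n
    simpa [r.map_zero] using this
  -- The path from r n through 1 along s starts at r n and has the limit line of `R (r n)⁻¹ w`. Its
  -- optimal contraction by `R (r n)`, read off at index n where the path meets 1, says that `R (r
  -- n)⁻¹` expands w almost by its full norm.
  have hcw (n : ℕ) : ‖R (r.toFun n)⁻¹‖ * ‖w‖ ≤ N * ‖R (r.toFun n)⁻¹ w‖ := by
    have hdom := isDominatedSeq_of_quasiGeodesic (D := D) (x := r.concat s n) hC h0 hθ hε hK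
      (r.concat_wordDist_succ s n) (GeodesicRay.le_concat_wordDist hD n)
    obtain ⟨Q', hQ', -⟩ := hdom.exists_tendsto hR hθ 0
    simp only [zero_add] at hQ'
    have hQ'' := hQ'.comp (tendsto_add_atTop_nat n)
    have hfix : Q' (R (r.toFun n)⁻¹ w) = R (r.toFun n)⁻¹ w := by
      refine limit_lineProj_map_inv hR (y := fun m => (r.toFun n)⁻¹ * s.toFun m)
        (by simpa using hQ) ?_ ?_ hw
      · refine hQ''.congr fun m => ?_
        simp only [Function.comp, r.concat_zero, add_comm m n, r.concat_add]
      · refine squeeze_zero (fun m => (hR _).nonneg) (g := fun m => C / θ ^ D * θ ^ (m + n))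
          (fun m => ?_) ?_
        · have := hdom.eps_le 0 (m + n)
          simpa only [zero_add, r.concat_zero, add_comm m n, r.concat_add] using this
        · have := (tendsto_pow_atTop_nhds_zero_of_lt_one h0.le hθ).comp (tendsto_add_atTop_nat n)
          simpa using this.const_mul (C / θ ^ D)
    have := hN _ hdom Q' hQ' _ hfix n
    rw [r.concat_zero, r.concat_self, inv_one, one_mul, mul_one, ← mul_apply_eq_comp,
      ← map_mul, mul_inv_cancel, map_one, one_apply_eq_self] at this
    exact this
  -- the resulting estimate for the relative error `ε (r n)`
  have hmain (n : ℕ) (hn : ε (r.toFun n) * M ≤ 1 / 2) :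
      b ^ 2 ≤ N * ‖ω‖ ^ 2 * (2 * M + 1) * ε (r.toFun n) := by
    set g := r.toFun n
    have hs := (hR g).norm_pos
    have he := (hR g).nonneg
    have hgg (y : H) : R g (R g⁻¹ y) = y := by
      rw [← mul_apply_eq_comp, ← map_mul, mul_inv_cancel, map_one, one_apply_eq_self]
    have hinv (x y : H) : ω (R g⁻¹ x) y = ω x (R g y) := by
      rw [← hω g, hgg]
    -- The line of `u g` is within O(ε) of v, which is assumed orthogonal to w.
    have hωu : ‖ω w (u g)‖ ≤ 2 * ‖ω‖ * M * ε g * ‖w‖ := by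
      have h1 : ‖v - lineProj (u g) v‖ ≤ ε g * M * ‖v‖ := by
        have := (hR g).norm_sub_le (R g⁻¹ v)
        rw [hgg] at this
        calc _ ≤ ε g * ‖R g‖ * ‖R g⁻¹ v‖ := this
          _ = ε g * (‖R g‖ * ‖R g⁻¹ v‖) := by ring
          _ ≤ ε g * (M * ‖v‖) := mul_le_mul_of_nonneg_left (hcv n) he
          _ = _ := by ring
      set c : ℂ := inner ℂ (u g) v with hc
      have h2 : lineProj (u g) v = c • u g := lineProj_apply _ _
      have h3 : ‖v‖ / 2 ≤ ‖c‖ := by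
        have h4 : ‖lineProj (u g) v‖ = ‖c‖ := by rw [h2, norm_smul, (hR g).norm_eq, mul_one]
        have h5 := norm_sub_norm_le v (lineProj (u g) v)
        have h6 : ε g * M * ‖v‖ ≤ 1 / 2 * ‖v‖ := by gcongr
        rw [h4] at h5
        linarith
      have h4 : c * ω w (u g) = -ω w (v - lineProj (u g) v) := by
        rw [map_sub, hωwv, h2, map_smul, smul_eq_mul]; ring
      have h5 : ‖c‖ * ‖ω w (u g)‖ ≤ ‖ω‖ * ‖w‖ * (ε g * M * ‖v‖) := by
        rw [← norm_mul, h4, norm_neg]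
        refine (ω.le_opNorm₂ _ _).trans ?_
        gcongr
      have h6 : ‖v‖ / 2 * ‖ω w (u g)‖ ≤ ‖ω‖ * ‖w‖ * (ε g * M * ‖v‖) :=
        le_trans (by gcongr) h5
      have h7 : ‖v‖ * ‖ω w (u g)‖ ≤ ‖v‖ * (2 * ‖ω‖ * M * ε g * ‖w‖) := by linarith
      exact le_of_mul_le_mul_left h7 hv1
    -- By invariance `ω (R g⁻¹ w) y = ω w (R g y)`, and `R g y` is nearly a multiple of `u g`.
    -- Together with `hcw` and `hnorm` this bounds `ε g` away from 0.
    have hw' : b * ‖R g⁻¹ w‖ ≤ ‖R g‖ * (‖ω‖ * (2 * M + 1) * ε g * ‖w‖) := by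
      refine (hnd _).trans (ContinuousLinearMap.opNorm_le_bound _ (by positivity) fun y => ?_)
      rw [hinv]
      have h1 : ω w (R g y) = (inner ℂ (u g) (R g y) : ℂ) * ω w (u g)
          + ω w (R g y - lineProj (u g) (R g y)) := by
        rw [map_sub, lineProj_apply, map_smul, smul_eq_mul]; ring
      have h2 : ‖(inner ℂ (u g) (R g y) : ℂ)‖ ≤ ‖R g‖ * ‖y‖ := by
        have := norm_inner_le_norm (𝕜 := ℂ) (u g) (R g y)
        rw [(hR g).norm_eq, one_mul] at this
        exact this.trans ((R g).le_opNorm y)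
      rw [h1]
      calc _ ≤ ‖(inner ℂ (u g) (R g y) : ℂ)‖ * ‖ω w (u g)‖
            + ‖ω w (R g y - lineProj (u g) (R g y))‖ := by
            rw [← norm_mul]; exact norm_add_le _ _
        _ ≤ ‖R g‖ * ‖y‖ * (2 * ‖ω‖ * M * ε g * ‖w‖) + ‖ω‖ * ‖w‖ * (ε g * ‖R g‖ * ‖y‖) := by
            gcongr
            refine (ω.le_opNorm₂ _ _).trans ?_
            gcongr
            exact (hR g).norm_sub_le y
        _ = _ := by ring
    -- `R g⁻¹` is the ω-adjoint of `R g`, so their norms are comparable.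
    have hnorm : b * ‖R g‖ ≤ ‖ω‖ * ‖R g⁻¹‖ := by
      rw [mul_comm b, ← le_div_iff₀ hb]
      refine ContinuousLinearMap.opNorm_le_bound _ (by positivity) fun y => ?_
      rw [div_mul_eq_mul_div, le_div_iff₀ hb, mul_comm _ b]
      refine (hnd _).trans (ContinuousLinearMap.opNorm_le_bound _ (by positivity) fun z => ?_)
      have : ω (R g y) z = ω y (R g⁻¹ z) := by rw [← hω g y, hgg]
      rw [this]
      calc _ ≤ ‖ω‖ * ‖y‖ * ‖R g⁻¹ z‖ := ω.le_opNorm₂ _ _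
        _ ≤ ‖ω‖ * ‖y‖ * (‖R g⁻¹‖ * ‖z‖) := by gcongr; exact (R g⁻¹).le_opNorm z
        _ = _ := by ring
    have hfin : (‖R g‖ * ‖w‖) * b ^ 2 ≤
        (‖R g‖ * ‖w‖) * (N * ‖ω‖ ^ 2 * (2 * M + 1) * ε g) := by
      calc (‖R g‖ * ‖w‖) * b ^ 2 = (b * ‖R g‖) * ‖w‖ * b := by ring
        _ ≤ (‖ω‖ * ‖R g⁻¹‖) * ‖w‖ * b := by gcongr
        _ = ‖ω‖ * (‖R g⁻¹‖ * ‖w‖) * b := by ring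
        _ ≤ ‖ω‖ * (N * ‖R g⁻¹ w‖) * b :=
            mul_le_mul_of_nonneg_right (mul_le_mul_of_nonneg_left (hcw n) (norm_nonneg ω)) hb.le
        _ = ‖ω‖ * N * (b * ‖R g⁻¹ w‖) := by ring
        _ ≤ ‖ω‖ * N * (‖R g‖ * (‖ω‖ * (2 * M + 1) * ε g * ‖w‖)) := by gcongr
        _ = _ := by ring
    exact le_of_mul_le_mul_left hfin (by positivity)
  have hlim : Tendsto (fun n => ε (r.toFun n)) atTop (𝓝 0) := by
    refine squeeze_zero (g := fun n => C * θ ^ n) (fun n => (hR _).nonneg) (fun n => ?_) ?_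
    · have := hε (r.toFun n)
      rwa [wordLength, r.wordDist_one] at this
    · simpa using (tendsto_pow_atTop_nhds_zero_of_lt_one h0.le hθ).const_mul C
  have hev : ∀ᶠ n in atTop, ε (r.toFun n) * M ≤ 1 / 2 := by
    have h1 : Tendsto (fun n => ε (r.toFun n) * M) atTop (𝓝 0) := by simpa using hlim.mul_const M
    exact h1.eventually_le_const (by norm_num)
  have h2 : b ^ 2 ≤ N * ‖ω‖ ^ 2 * (2 * M + 1) * 0 :=
    ge_of_tendsto (hlim.const_mul _) (hev.mono fun n hn => hmain n hn)
  rw [mul_zero] at h2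
  have : 0 < b ^ 2 := by positivity
  linarith

end LimitMap

/-! ### The continuous boundary map and the topological contradiction. -/

section BoundaryMap

open Filter Topology InnerProductSpace

variable {H : Type*} [NormedAddCommGroup H] [InnerProductSpace ℂ H]
  {Γ : Type*} [Group Γ] {S : Set Γ} {R : Γ →* (H →L[ℂ] H)} {u : Γ → H} {ε : Γ → ℝ}

theorem inner_limit_lineProj {x : ℕ → H} {Q : H →L[ℂ] H}
    (hQ : Tendsto (fun n => lineProj (x n)) atTop (𝓝 Q)) (a b : H) :
    (inner ℂ (Q a) b : ℂ) = inner ℂ a (Q b) := by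
  have happ (c : H) : Tendsto (fun n => lineProj (x n) c) atTop (𝓝 (Q c)) :=
    ((ContinuousLinearMap.apply ℂ H c).continuous.tendsto Q).comp hQ
  have h1 := (happ a).inner (𝕜 := ℂ) (tendsto_const_nhds (x := b))
  have h2 := (tendsto_const_nhds (x := a)).inner (𝕜 := ℂ) (happ b)
  refine tendsto_nhds_unique h1 (h2.congr fun n => ?_)
  rw [lineProj_apply, lineProj_apply, inner_smul_left, inner_smul_right, inner_conj_symm, mul_comm]

theorem limit_lineProj_idem {x : ℕ → H} (hx : ∀ n, ‖x n‖ = 1) {Q : H →L[ℂ] H}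
    (hQ : Tendsto (fun n => lineProj (x n)) atTop (𝓝 Q)) (a : H) : Q (Q a) = Q a := by
  have h : Q * Q = Q := by
    refine tendsto_nhds_unique (hQ.mul hQ) (hQ.congr fun n => ?_)
    ext y
    simp [lineProj_apply, hx n]
  exact DFunLike.congr_fun h a

/-- Projections to lines have norm 1, and norm convergence preserves this. -/
theorem limit_lineProj_ne_zero {x : ℕ → H} (hx : ∀ n, ‖x n‖ = 1) {Q : H →L[ℂ] H}
    (hQ : Tendsto (fun n => lineProj (x n)) atTop (𝓝 Q)) : Q ≠ 0 := by
  have h : ‖Q‖ = 1 := by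
    refine tendsto_nhds_unique hQ.norm (tendsto_const_nhds.congr fun n => ?_)
    simp [lineProj, hx n]
  rintro rfl
  simp at h

theorem GeodesicRay.continuous_comp_eval {X : Type*} [TopologicalSpace X] (f : Γ → X) (n : ℕ) :
    Continuous fun r : GeodesicRay S => f (r.toFun n) := by
  let : TopologicalSpace Γ := ⊥
  have h1 : Continuous f := continuous_bot
  have h2 : Continuous (GeodesicRay.toFun : GeodesicRay S → ℕ → Γ) := continuous_induced_dom
  exact h1.comp ((continuous_apply n).comp h2)

/-- The limit map of a dominated representation. It sends a boundary point to the orthogonal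
projection to its limit line. -/
theorem exists_boundary_map [CompleteSpace H] (hfin : S.Finite) (hgen : Subgroup.closure S = ⊤)
    (hR : ∀ γ, IsDominated (R γ) (u γ) (ε γ)) {C θ : ℝ} (hC : 0 ≤ C) (h0 : 0 < θ) (hθ : θ < 1)
    (hε : ∀ γ, ε γ ≤ C * θ ^ wordLength S γ) :
    ∃ ξ : GromovBoundary S → H →L[ℂ] H, Continuous ξ ∧ ∀ r : GeodesicRay S,
      Tendsto (fun n => lineProj (u (r.toFun n))) atTop (𝓝 (ξ (Quotient.mk _ r))) := by
  obtain ⟨K, hK1, hK⟩ := exists_norm_le_of_generators hfin R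
  have hex (r : GeodesicRay S) := (r.isDominatedSeq hC h0 hθ hε hK).exists_tendsto hR hθ 0
  simp only [zero_add, GeodesicRay.map_zero, inv_one, one_mul] at hex
  choose ξ hξ hξb using hex
  have hcont : Continuous ξ := by
    -- The rate of convergence is the same for all rays, and each approximant depends on a single
    -- vertex of the ray, hence is continuous.
    have hunif : TendstoUniformly (fun n (r : GeodesicRay S) => lineProj (u (r.toFun n)))
        ξ atTop := by
      rw [Metric.tendstoUniformly_iff]
      intro e he
      have hlim : Tendsto (fun n => 2 * C * K ^ 2 * θ ^ n / (1 - θ)) atTop (𝓝 0) := by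
        simpa using ((tendsto_pow_atTop_nhds_zero_of_lt_one h0.le hθ).const_mul
          (2 * C * K ^ 2)).div_const (1 - θ)
      filter_upwards [hlim.eventually_lt_const he] with n hn r
      rw [dist_comm, dist_eq_norm]
      exact (hξb r n).trans_lt hn
    exact hunif.continuous (Eventually.frequently (Eventually.of_forall fun n =>
      GeodesicRay.continuous_comp_eval (fun γ => lineProj (u γ)) n))
  -- The points r n and s n differ by an element of length at most D, whose condition number is
  -- bounded, so their lines merge as ε tends to 0.
  have hresp (r s : GeodesicRay S) (hrs : r.Asymptotic s) : ξ r = ξ s := by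
    obtain ⟨D, hD⟩ := hrs
    have hpow (g : Γ) (hg : wordLength S g ≤ D) : ‖R g‖ ≤ K ^ D :=
      (le_pow_wordLength hgen (ν := fun g => ‖R g‖) hK1
        (by rw [map_one]; exact ContinuousLinearMap.norm_id_le)
        (fun g => norm_nonneg _) (norm_map_mul_le R) hK g).trans (pow_le_pow_right₀ hK1 hg)
    have hdiff : Tendsto (fun n => lineProj (u (r.toFun n)) - lineProj (u (s.toFun n)))
        atTop (𝓝 0) := by
      refine squeeze_zero_norm (a := fun n => 2 * (C * θ ^ n * (K ^ D * K ^ D))) (fun n => ?_) ?_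
      · have h1 := norm_lineProj_mul_sub_le hR (r.toFun n) ((r.toFun n)⁻¹ * s.toFun n)
        rw [mul_inv_cancel_left] at h1
        refine h1.trans ?_
        have h2 := hε (r.toFun n)
        rw [wordLength, r.wordDist_one] at h2
        have h3 : wordLength S ((r.toFun n)⁻¹ * s.toFun n) ≤ D := by
          rw [wordLength_inv_mul]; exact hD n
        have h4 := hpow _ h3
        have h5 := hpow ((r.toFun n)⁻¹ * s.toFun n)⁻¹ (by rwa [wordLength_inv])
        gcongr
      · have := ((tendsto_pow_atTop_nhds_zero_of_lt_one h0.le hθ).const_mul C).mul_const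
          (K ^ D * K ^ D)
        simpa using this.const_mul 2
    exact sub_eq_zero.1 (tendsto_nhds_unique ((hξ r).sub (hξ s)) hdiff)
  refine ⟨Quotient.lift ξ hresp, hcont.quotient_lift hresp, fun r => hξ r⟩

/-- A word hyperbolic group whose boundary properly contains a 2-sphere has no dominated
representation that preserves a nondegenerate alternating form. -/
theorem not_properlyContainsTwoSphere_of_alternating [CompleteSpace H]
    (hS : IsWordHyperbolic S)
    (hR : ∀ γ, IsDominated (R γ) (u γ) (ε γ)) {C θ : ℝ} (hC : 0 ≤ C) (h0 : 0 < θ) (hθ : θ < 1)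
    (hε : ∀ γ, ε γ ≤ C * θ ^ wordLength S γ)
    {ω : H →L[ℂ] H →L[ℂ] ℂ} (hω : ∀ γ x y, ω (R γ x) (R γ y) = ω x y)
    (hskew : ∀ x y, ω x y = -ω y x)
    {b : ℝ} (hb : 0 < b) (hnd : ∀ w, b * ‖w‖ ≤ ‖ω w‖) :
    ¬ ProperlyContainsTwoSphere (GromovBoundary S) := by
  rintro ⟨f, hf, hrange⟩
  obtain ⟨z, hz⟩ := (Set.ne_univ_iff_exists_notMem _).1 hrange
  obtain ⟨ξ, hξc, hξ⟩ := exists_boundary_map hS.finite hS.closure_eq_top hR hC h0 hθ hε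
  have hlim (x : GromovBoundary S) : ∃ y : ℕ → H, (∀ n, ‖y n‖ = 1) ∧
      Tendsto (fun n => lineProj (y n)) atTop (𝓝 (ξ x)) := by
    obtain ⟨r, rfl⟩ := Quotient.exists_rep x
    exact ⟨_, fun n => (hR _).norm_eq, hξ r⟩
  have hidem (x) (a : H) : ξ x (ξ x a) = ξ x a := by
    obtain ⟨y, hy, hyl⟩ := hlim x
    exact limit_lineProj_idem hy hyl a
  have hfix (x) : ∃ v, v ≠ 0 ∧ ξ x v = v := by
    obtain ⟨y, hy, hyl⟩ := hlim x
    obtain ⟨a, ha⟩ := DFunLike.ne_iff.1 (limit_lineProj_ne_zero hy hyl)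
    exact ⟨ξ x a, ha, hidem x a⟩
  have htrans (x y : GromovBoundary S) (hxy : x ≠ y) (v w : H) (hv : ξ x v = v) (hw : ξ y w = w)
      (hv0 : v ≠ 0) (hw0 : w ≠ 0) : ω w v ≠ 0 := by
    obtain ⟨r, rfl⟩ := Quotient.exists_rep x
    obtain ⟨s, rfl⟩ := Quotient.exists_rep y
    exact form_ne_zero_of_not_asymptotic hS hR hC h0 hθ hε hω hb hnd
      (fun h => hxy (Quotient.sound h)) (hξ r) (hξ s) hv hw hv0 hw0
  obtain ⟨w, hw0, hw⟩ := hfix z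
  -- The Riesz vector t of `ω w` supplies the section x ↦ `ξ x t`: it could vanish only if the line
  -- of x were orthogonal to t, that is, ω-orthogonal to w.
  obtain ⟨t, ht⟩ : ∃ t : H, ∀ y, (inner ℂ t y : ℂ) = ω w y :=
    ⟨(toDual ℂ H).symm (ω w), fun y => by simp⟩
  have hp (x : GromovBoundary S) (hx : x ≠ z) : ξ x t ≠ 0 := by
    intro h
    obtain ⟨v, hv0, hv⟩ := hfix x
    refine htrans x z hx v w hv hw hv0 hw0 ?_
    obtain ⟨y, hy, hyl⟩ := hlim x
    rw [← ht, ← hv, ← inner_limit_lineProj hyl, h, inner_zero_left]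
  have hfz (x) : f x ≠ z := fun h => hz ⟨x, h⟩
  have hpc : Continuous fun x => ξ (f x) t := (hξc.comp hf.continuous).clm_apply continuous_const
  obtain ⟨x, hx⟩ := exists_sphere_eq_zero_of_odd (fun x => ω (ξ (f x) t) (ξ (f (-x)) t))
    ((ω.continuous.comp hpc).clm_apply (hpc.comp continuous_neg))
    (fun x => by rw [neg_neg]; exact hskew _ _)
  refine htrans (f (-x)) (f x) (fun h => ?_) _ _ (hidem _ t) (hidem _ t) (hp _ (hfz _))
    (hp _ (hfz _)) hx
  exact ne_neg_of_mem_unit_sphere ℝ x (hf.injective h).symm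

end BoundaryMap

/-! ### Exterior powers as antisymmetric tensors, and the wedge pairing. -/

section TensorPower

open Equiv Equiv.Perm

variable {n : Type*} {k : ℕ}

/-- The `k`-th tensor power of a matrix. -/
def tensorPow (k : ℕ) (g : Matrix n n ℂ) : Matrix (Fin k → n) (Fin k → n) ℂ :=
  Matrix.of fun i j => ∏ a, g (i a) (j a)

theorem tensorPow_apply (g : Matrix n n ℂ) (i j : Fin k → n) :
    tensorPow k g i j = ∏ a, g (i a) (j a) := rfl

theorem tensorPow_mul [Fintype n] (g h : Matrix n n ℂ) :
    tensorPow k (g * h) = tensorPow k g * tensorPow k h := by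
  ext i j
  simp only [tensorPow_apply, Matrix.mul_apply, Finset.prod_univ_sum, Fintype.piFinset_univ,
    Finset.prod_mul_distrib]

theorem tensorPow_diagonal [DecidableEq n] (s : n → ℂ) :
    tensorPow k (Matrix.diagonal s) = Matrix.diagonal fun i : Fin k → n => ∏ a, s (i a) := by
  ext i j
  rw [tensorPow_apply]
  rcases eq_or_ne i j with rfl | h
  · simp
  · obtain ⟨a, ha⟩ := Function.ne_iff.1 h
    rw [Matrix.diagonal_apply_ne _ h]
    exact Finset.prod_eq_zero (Finset.mem_univ a) (Matrix.diagonal_apply_ne _ ha)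

theorem tensorPow_one [DecidableEq n] : tensorPow k (1 : Matrix n n ℂ) = 1 := by
  rw [← Matrix.diagonal_one, tensorPow_diagonal]
  simp

theorem tensorPow_conjTranspose (g : Matrix n n ℂ) :
    tensorPow k g.conjTranspose = (tensorPow k g).conjTranspose := by
  ext i j
  simp [tensorPow_apply, Matrix.conjTranspose_apply]

/-- The space of antisymmetric `k`-tensors. -/
def antisymTensor (k : ℕ) (n : Type*) [Fintype n] :
    Submodule ℂ (EuclideanSpace ℂ (Fin k → n)) where
  carrier := {x | ∀ (τ : Perm (Fin k)) (i : Fin k → n), x (i ∘ τ) = ((sign τ : ℤ) : ℂ) * x i}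
  add_mem' hx hy τ i := by simp [hx τ i, hy τ i, mul_add]
  zero_mem' τ i := by simp
  smul_mem' c x hx τ i := by simp [hx τ i]; ring

theorem apply_eq_zero_of_not_injective [Fintype n] {x : EuclideanSpace ℂ (Fin k → n)}
    (hx : x ∈ antisymTensor k n) {i : Fin k → n} (hi : ¬ Function.Injective i) : x i = 0 := by
  simp only [Function.Injective, not_forall] at hi
  obtain ⟨a, b, hab, hne⟩ := hi
  have h := hx (swap a b) i
  have h2 : i ∘ swap a b = i := by
    ext c
    rcases eq_or_ne c a with rfl | hca
    · simp [hab]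
    rcases eq_or_ne c b with rfl | hcb
    · simp [hab]
    · simp [swap_apply_of_ne_of_ne hca hcb]
  rw [h2, sign_swap hne] at h
  simp at h
  linear_combination (1 / 2 : ℂ) * h

/-- Precomposition with a permutation as a permutation of the index set. -/
def compPerm (τ : Perm (Fin k)) : Perm (Fin k → n) :=
  Equiv.arrowCongr τ.symm (Equiv.refl n)

theorem compPerm_apply (τ : Perm (Fin k)) (i : Fin k → n) : compPerm τ i = i ∘ τ := by
  ext a; simp [compPerm]

theorem tensorPow_mem [Fintype n] [DecidableEq n] (g : Matrix n n ℂ)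
    {x : EuclideanSpace ℂ (Fin k → n)} (hx : x ∈ antisymTensor k n) :
    Matrix.toEuclideanCLM (𝕜 := ℂ) (tensorPow k g) x ∈ antisymTensor k n := by
  intro τ i
  simp only [Matrix.ofLp_toEuclideanCLM, Matrix.mulVec, dotProduct, tensorPow_apply]
  rw [← Equiv.sum_comp (compPerm τ), Finset.mul_sum]
  refine Finset.sum_congr rfl fun j _ => ?_
  rw [compPerm_apply, hx τ j]
  simp only [Function.comp]
  rw [Equiv.prod_comp τ fun a => g (i a) (j a)]
  ring

/-- The action of a matrix on antisymmetric tensors. -/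
noncomputable def antisymAction [Fintype n] [DecidableEq n] (k : ℕ) (g : Matrix n n ℂ) :
    antisymTensor k n →L[ℂ] antisymTensor k n :=
  ((Matrix.toEuclideanCLM (𝕜 := ℂ) (tensorPow k g)).comp (antisymTensor k n).subtypeL).codRestrict
    (antisymTensor k n) fun x => tensorPow_mem g x.2

theorem coe_antisymAction [Fintype n] [DecidableEq n] (g : Matrix n n ℂ) (x : antisymTensor k n) :
    (antisymAction k g x : EuclideanSpace ℂ (Fin k → n)) =
      Matrix.toEuclideanCLM (𝕜 := ℂ) (tensorPow k g) x := rfl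

theorem antisymAction_mul [Fintype n] [DecidableEq n] (g h : Matrix n n ℂ) :
    antisymAction k (g * h) = antisymAction k g * antisymAction k h := by
  ext1 x
  apply Subtype.ext
  rw [mul_apply_eq_comp, coe_antisymAction, coe_antisymAction, coe_antisymAction, tensorPow_mul,
    map_mul, mul_apply_eq_comp]

theorem antisymAction_one [Fintype n] [DecidableEq n] : antisymAction k (1 : Matrix n n ℂ) = 1 := by
  ext1 x
  apply Subtype.ext
  rw [coe_antisymAction, tensorPow_one, map_one]
  rfl

/-- The antisymmetrization of the basis tensor with index `i₀`. -/
def antisymBasis [DecidableEq n] (i₀ : Fin k → n) : EuclideanSpace ℂ (Fin k → n) :=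
  WithLp.toLp 2 fun i => ∑ τ : Perm (Fin k), if i = i₀ ∘ τ then ((sign τ : ℤ) : ℂ) else 0

theorem antisymBasis_apply [DecidableEq n] (i₀ i : Fin k → n) : antisymBasis i₀ i =
    ∑ τ : Perm (Fin k), if i = i₀ ∘ τ then ((sign τ : ℤ) : ℂ) else 0 := rfl

theorem antisymBasis_mem [Fintype n] [DecidableEq n] (i₀ : Fin k → n) :
    antisymBasis i₀ ∈ antisymTensor k n := by
  intro τ i
  rw [antisymBasis_apply, antisymBasis_apply, ← Equiv.sum_comp (Equiv.mulRight τ), Finset.mul_sum]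
  refine Finset.sum_congr rfl fun ρ _ => ?_
  have h : i ∘ τ = i₀ ∘ (ρ * τ : Perm (Fin k)) ↔ i = i₀ ∘ ρ := by
    rw [coe_mul, ← Function.comp_assoc]
    exact τ.surjective.injective_comp_right.eq_iff
  simp only [Equiv.coe_mulRight, h, Perm.sign_mul, Units.val_mul, Int.cast_mul]
  split_ifs
  · ring
  · simp

theorem antisymBasis_comp [DecidableEq n] {i₀ : Fin k → n} (hi : Function.Injective i₀)
    (τ : Perm (Fin k)) :
    antisymBasis i₀ (i₀ ∘ τ) = ((sign τ : ℤ) : ℂ) := by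
  rw [antisymBasis_apply, Finset.sum_eq_single τ]
  · simp
  · intro ρ _ hρ
    rw [if_neg]
    intro h
    exact hρ (DFunLike.coe_injective (hi.comp_left h)).symm
  · simp

theorem antisymBasis_eq_zero [DecidableEq n] {i₀ i : Fin k → n}
    (h : ∀ τ : Perm (Fin k), i ≠ i₀ ∘ τ) :
    antisymBasis i₀ i = 0 := by
  rw [antisymBasis_apply]
  exact Finset.sum_eq_zero fun τ _ => if_neg (h τ)

/-- The exterior product of two `k`-tensors in dimension `2k`. -/
noncomputable def wedgeForm (e : Fin k ⊕ Fin k ≃ n) (x y : EuclideanSpace ℂ (Fin k → n)) : ℂ :=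
  ∑ π : Perm (Fin k ⊕ Fin k),
    ((sign π : ℤ) : ℂ) * x (e ∘ π ∘ Sum.inl) * y (e ∘ π ∘ Sum.inr)

/-- After expanding both tensor powers, the sum over permutations is the Leibniz formula. -/
theorem wedgeForm_tensorPow [Fintype n] [DecidableEq n] (e : Fin k ⊕ Fin k ≃ n) (g : Matrix n n ℂ)
    (x y : EuclideanSpace ℂ (Fin k → n)) :
    wedgeForm e (Matrix.toEuclideanCLM (𝕜 := ℂ) (tensorPow k g) x)
      (Matrix.toEuclideanCLM (𝕜 := ℂ) (tensorPow k g) y) =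
    ∑ i, ∑ j, x i * y j * (g.submatrix e (Sum.elim i j)).det := by
  simp only [wedgeForm, Matrix.ofLp_toEuclideanCLM, Matrix.mulVec, dotProduct, Matrix.det_apply',
    tensorPow_apply, Finset.mul_sum, Finset.sum_mul]
  rw [Finset.sum_comm]
  conv_lhs => enter [2, j]; rw [Finset.sum_comm]
  rw [Finset.sum_comm]
  refine Finset.sum_congr rfl fun i _ => Finset.sum_congr rfl fun j _ =>
    Finset.sum_congr rfl fun π _ => ?_
  simp only [Function.comp, Fintype.prod_sum_type, Matrix.submatrix_apply, Sum.elim_inl,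
    Sum.elim_inr]
  ring

/-- In the determinant expansion, passing from the identity to g multiplies each minor by `g.det`,
as column selection is right multiplication by a selection matrix. -/
theorem wedgeForm_invariant [Fintype n] [DecidableEq n] (e : Fin k ⊕ Fin k ≃ n) (g : Matrix n n ℂ)
    (x y : EuclideanSpace ℂ (Fin k → n)) :
    wedgeForm e (Matrix.toEuclideanCLM (𝕜 := ℂ) (tensorPow k g) x)
      (Matrix.toEuclideanCLM (𝕜 := ℂ) (tensorPow k g) y) = g.det * wedgeForm e x y := by
  have h1 := wedgeForm_tensorPow e 1 x y
  rw [tensorPow_one, map_one, one_apply_eq_self, one_apply_eq_self] at h1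
  rw [wedgeForm_tensorPow, h1, Finset.mul_sum]
  refine Finset.sum_congr rfl fun i _ => ?_
  rw [Finset.mul_sum]
  refine Finset.sum_congr rfl fun j _ => ?_
  have h2 : g.submatrix e (Sum.elim i j) =
      g.submatrix e e * (1 : Matrix n n ℂ).submatrix e (Sum.elim i j) := by
    rw [Matrix.submatrix_mul_equiv, mul_one]
  rw [h2, Matrix.det_mul, Matrix.det_submatrix_equiv_self]
  ring

/-- Exchanging the two halves is a product of k disjoint transpositions. -/
theorem sign_sumComm (k : ℕ) :
    sign (Equiv.sumComm (Fin k) (Fin k) : Perm (Fin k ⊕ Fin k)) = (-1) ^ k := by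
  let f : Fin k ⊕ Fin k ≃ Fin k × Bool := (Equiv.boolProdEquivSum (Fin k)).symm.trans
    (Equiv.prodComm Bool (Fin k))
  rw [← sign_permCongr f]
  have : f.permCongr (Equiv.sumComm (Fin k) (Fin k) : Perm (Fin k ⊕ Fin k)) =
      prodCongrRight fun _ => swap false true := by
    ext1 ⟨a, c⟩
    cases c <;> rfl
  rw [this, sign_prodCongrRight]
  simp

theorem wedgeForm_skew (hk : Odd k) (e : Fin k ⊕ Fin k ≃ n)
    (x y : EuclideanSpace ℂ (Fin k → n)) : wedgeForm e x y = -wedgeForm e y x := by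
  rw [wedgeForm, wedgeForm, ← Finset.sum_neg_distrib,
    ← Equiv.sum_comp (Equiv.mulRight (Equiv.sumComm (Fin k) (Fin k) : Perm (Fin k ⊕ Fin k)))]
  refine Finset.sum_congr rfl fun π _ => ?_
  have h1 : (π * (Equiv.sumComm (Fin k) (Fin k) : Perm (Fin k ⊕ Fin k)) : Perm _) ∘ Sum.inl
      = π ∘ Sum.inr := rfl
  have h2 : (π * (Equiv.sumComm (Fin k) (Fin k) : Perm (Fin k ⊕ Fin k)) : Perm _) ∘ Sum.inr
      = π ∘ Sum.inl := rfl
  simp only [Equiv.coe_mulRight]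
  rw [h1, h2, Perm.sign_mul, sign_sumComm, hk.neg_one_pow]
  simp
  ring

theorem exists_perm_comp_inl {i : Fin k → n} (hi : Function.Injective i)
    (e : Fin k ⊕ Fin k ≃ n) : ∃ π : Perm (Fin k ⊕ Fin k), e ∘ π ∘ Sum.inl = i := by
  classical
  have hj : Function.Injective (e.symm ∘ i) := e.symm.injective.comp hi
  let f := (Equiv.ofInjective (Sum.inl : Fin k → Fin k ⊕ Fin k) Sum.inl_injective).symm.trans
    (Equiv.ofInjective _ hj)
  refine ⟨f.extendSubtype, funext fun a => ?_⟩
  have h := Equiv.extendSubtype_apply_of_mem f (Sum.inl a) ⟨a, rfl⟩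
  simp only [Function.comp, h, f, Equiv.trans_apply]
  rw [Equiv.ofInjective_symm_apply]
  simp

/-- Pair y with the basis tensor on the indices complementary to those of a nonzero coordinate. -/
theorem exists_wedgeForm_ne_zero [Fintype n] (e : Fin k ⊕ Fin k ≃ n)
    {y : EuclideanSpace ℂ (Fin k → n)} (hy : y ∈ antisymTensor k n) (hy0 : y ≠ 0) :
    ∃ x ∈ antisymTensor k n, wedgeForm e x y ≠ 0 := by
  classical
  obtain ⟨j₀, hj₀⟩ : ∃ j, y j ≠ 0 := by
    by_contra! h
    exact hy0 (by ext j; simpa using h j)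
  have hinj : Function.Injective j₀ := by
    by_contra h
    exact hj₀ (apply_eq_zero_of_not_injective hy h)
  obtain ⟨π₁, hπ₁⟩ := exists_perm_comp_inl hinj e
  set π₀ : Perm (Fin k ⊕ Fin k) := π₁ * (Equiv.sumComm (Fin k) (Fin k) : Perm _) with hπ₀
  have hr : e ∘ π₀ ∘ Sum.inr = j₀ := hπ₁
  set i₀ : Fin k → n := e ∘ π₀ ∘ Sum.inl with hi₀
  refine ⟨antisymBasis i₀, antisymBasis_mem i₀, ?_⟩
  -- A contributing π differs from `π₀` by a block permutation, and its sign cancels against those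
  -- coming from x and y. All contributing terms are thus equal, and their number is nonzero in ℂ.
  have hterm (π : Perm (Fin k ⊕ Fin k)) (τ : Perm (Fin k)) (h : e ∘ π ∘ Sum.inl = i₀ ∘ τ) :
      ((sign π : ℤ) : ℂ) * ((sign τ : ℤ) : ℂ) * y (e ∘ π ∘ Sum.inr) =
        ((sign π₀ : ℤ) : ℂ) * y j₀ := by
    have hρ (a : Fin k) : (π₀⁻¹ * π) (Sum.inl a) = Sum.inl (τ a) := by
      have := congrFun h a
      simp only [hi₀, Function.comp, EmbeddingLike.apply_eq_iff_eq] at this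
      rw [Perm.mul_apply, this, Perm.inv_def, Equiv.symm_apply_apply]
    obtain ⟨⟨τ₁, τ₂⟩, hτ⟩ := mem_sumCongrHom_range_of_perm_mapsTo_inl (σ := π₀⁻¹ * π)
      (by rintro _ ⟨a, rfl⟩; exact ⟨τ a, (hρ a).symm⟩)
    have hτ₁ : τ₁ = τ := by
      ext1 a
      have := hρ a
      rw [← hτ] at this
      simpa [sumCongrHom] using this
    have hπ : π = π₀ * Perm.sumCongr τ τ₂ := by
      rw [← hτ₁]
      exact (eq_inv_mul_iff_mul_eq.1 hτ).symm
    have h3 : e ∘ π ∘ Sum.inr = j₀ ∘ τ₂ := by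
      rw [hπ, ← hr]; rfl
    rw [h3, hy τ₂, hπ, Perm.sign_mul, sign_sumCongr]
    rcases Int.units_eq_one_or (sign τ) with h4 | h4 <;>
      rcases Int.units_eq_one_or (sign τ₂) with h5 | h5 <;> simp [h4, h5]
  have hsum : wedgeForm e (antisymBasis i₀) y = ∑ p : Perm (Fin k ⊕ Fin k) × Perm (Fin k),
      if e ∘ p.1 ∘ Sum.inl = i₀ ∘ p.2 then ((sign π₀ : ℤ) : ℂ) * y j₀ else 0 := by
    rw [wedgeForm, Fintype.sum_prod_type]
    refine Finset.sum_congr rfl fun π _ => ?_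
    rw [antisymBasis_apply, Finset.mul_sum, Finset.sum_mul]
    refine Finset.sum_congr rfl fun τ _ => ?_
    split_ifs with h
    · exact hterm π τ h
    · simp
  rw [hsum, ← Finset.sum_filter, Finset.sum_const, nsmul_eq_mul]
  refine mul_ne_zero ?_ (mul_ne_zero ?_ hj₀)
  · rw [Nat.cast_ne_zero, Finset.card_ne_zero]
    exact ⟨(π₀, 1), by simp [hi₀]⟩
  · simp

end TensorPower

/-! ### Singular values of exterior powers. -/

section SingularValues

open Module

theorem prod_le_prod_range_card {σ : ℕ → ℝ} (hσ : Antitone σ) (h0 : ∀ m, 0 ≤ σ m)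
    (F : Finset ℕ) : ∏ m ∈ F, σ m ≤ ∏ m ∈ Finset.range F.card, σ m := by
  induction F using Finset.induction_on_max with
  | empty => simp
  | insert M F hM ih =>
    have hMF : M ∉ F := fun h => lt_irrefl _ (hM M h)
    have hcard : F.card ≤ M := by
      simpa using Finset.card_le_card (t := Finset.range M) fun m hm => by simpa using hM m hm
    rw [Finset.prod_insert hMF, Finset.card_insert_of_notMem hMF, Finset.prod_range_succ, mul_comm]
    exact mul_le_mul ih (hσ hcard) (h0 _) (Finset.prod_nonneg fun m _ => h0 m)

/-- Such a set contains an index at least k + 1; the other k factors are bounded by the k largest.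
-/
theorem prod_le_of_ne_range {σ : ℕ → ℝ} (hσ : Antitone σ) (h0 : ∀ m, 0 ≤ σ m) {k : ℕ}
    {F : Finset ℕ} (hF : F.card = k + 1) (hne : F ≠ Finset.range (k + 1)) :
    ∏ m ∈ F, σ m ≤ (∏ m ∈ Finset.range k, σ m) * σ (k + 1) := by
  have hM : ∃ M ∈ F, k + 1 ≤ M := by
    by_contra! h
    exact hne (Finset.eq_of_subset_of_card_le (fun m hm => Finset.mem_range.2 (h m hm))
      (by simp [hF]))
  obtain ⟨M, hMF, hM⟩ := hM
  rw [← Finset.mul_prod_erase F σ hMF, mul_comm]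
  have h1 := prod_le_prod_range_card hσ h0 (F.erase M)
  rw [Finset.card_erase_of_mem hMF, hF, Nat.add_sub_cancel] at h1
  exact mul_le_mul h1 (hσ hM) (h0 _) (Finset.prod_nonneg fun m _ => h0 m)

theorem prod_comp_le {σ : ℕ → ℝ} (hσ : Antitone σ) (h0 : ∀ m, 0 ≤ σ m) {d k : ℕ}
    {i : Fin k → Fin d} (hi : Function.Injective i) :
    ∏ a, σ (i a) ≤ ∏ m ∈ Finset.range k, σ m := by
  have hinj : Function.Injective fun a => (i a : ℕ) := Fin.val_injective.comp hi
  have h := prod_le_prod_range_card hσ h0 (Finset.univ.image fun a => (i a : ℕ))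
  rwa [Finset.prod_image hinj.injOn, Finset.card_image_of_injective _ hinj, Finset.card_univ,
    Fintype.card_fin] at h

theorem prod_comp_le_of_ne {σ : ℕ → ℝ} (hσ : Antitone σ) (h0 : ∀ m, 0 ≤ σ m) {d k : ℕ}
    (hk : k + 1 ≤ d) {i : Fin (k + 1) → Fin d} (hi : Function.Injective i)
    (hne : ∀ τ : Equiv.Perm (Fin (k + 1)), i ≠ Fin.castLE hk ∘ τ) :
    ∏ a, σ (i a) ≤ (∏ m ∈ Finset.range k, σ m) * σ (k + 1) := by
  have hinj : Function.Injective fun a => (i a : ℕ) := Fin.val_injective.comp hi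
  rw [← Finset.prod_image (s := Finset.univ) (f := σ) hinj.injOn]
  refine prod_le_of_ne_range hσ h0 (by simp [Finset.card_image_of_injective _ hinj]) fun h => ?_
  have hlt (a) : (i a : ℕ) < k + 1 := by
    rw [← Finset.mem_range, ← h]
    exact Finset.mem_image_of_mem _ (Finset.mem_univ a)
  let f : Fin (k + 1) → Fin (k + 1) := fun a => ⟨i a, hlt a⟩
  have hf : Function.Injective f := fun a b hab => hinj (Fin.mk.inj_iff.1 hab)
  refine hne (Equiv.ofBijective f (Finite.injective_iff_bijective.1 hf)) (funext fun a => ?_)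
  ext
  simp [f]

theorem norm_sq_toEuclideanCLM_of_gram {ι : Type*} [Fintype ι] [DecidableEq ι]
    {M : Matrix ι ι ℂ} {c : ι → ℝ}
    (h : M.conjTranspose * M = Matrix.diagonal fun i => (c i : ℂ) ^ 2) (y : EuclideanSpace ℂ ι) :
    ‖Matrix.toEuclideanCLM (𝕜 := ℂ) M y‖ ^ 2 = ∑ i, c i ^ 2 * ‖y i‖ ^ 2 := by
  have h1 : (inner ℂ (Matrix.toEuclideanCLM (𝕜 := ℂ) M y) (Matrix.toEuclideanCLM (𝕜 := ℂ) M y) : ℂ)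
      = inner ℂ y (Matrix.toEuclideanCLM (𝕜 := ℂ) (M.conjTranspose * M) y) := by
    rw [map_mul, mul_apply_eq_comp, ← Matrix.star_eq_conjTranspose, map_star,
      ContinuousLinearMap.star_eq_adjoint, ContinuousLinearMap.adjoint_inner_right]
  rw [inner_self_eq_norm_sq_to_K, h, PiLp.inner_apply] at h1
  have h2 : ((‖Matrix.toEuclideanCLM (𝕜 := ℂ) M y‖ ^ 2 : ℝ) : ℂ)
      = ((∑ i, c i ^ 2 * ‖y i‖ ^ 2 : ℝ) : ℂ) := by
    push_cast
    refine h1.trans (Finset.sum_congr rfl fun i _ => ?_)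
    rw [Matrix.ofLp_toEuclideanCLM, Matrix.mulVec_diagonal, RCLike.inner_apply, mul_assoc,
      RCLike.mul_conj]
    rfl
  exact_mod_cast h2

/-- Diagonalization of the Gram matrix by a unitary matrix, in terms of singular values. -/
theorem exists_unitary_gram_eq_diagonal {d : ℕ} (g : Matrix (Fin d) (Fin d) ℂ) :
    ∃ V : Matrix (Fin d) (Fin d) ℂ, V.conjTranspose * V = 1 ∧ V * V.conjTranspose = 1 ∧
      (g * V).conjTranspose * (g * V) = Matrix.diagonal fun i : Fin d =>
        (((Matrix.toEuclideanLin g).singularValues i : ℝ) : ℂ) ^ 2 := by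
  set T := Matrix.toEuclideanLin g with hT
  have hd : finrank ℂ (EuclideanSpace ℂ (Fin d)) = d := by simp
  set e := T.isSymmetric_adjoint_comp_self.eigenvectorBasis hd with he
  have hgram (w : Fin d → EuclideanSpace ℂ (Fin d)) (i j : Fin d) :
      ((Matrix.of fun a i => w i a).conjTranspose * (Matrix.of fun a i => w i a)) i j
        = inner ℂ (w i) (w j) := by
    rw [Matrix.mul_apply, PiLp.inner_apply]
    refine Finset.sum_congr rfl fun a _ => ?_
    simp [mul_comm]
  have hV : (Matrix.of fun a i => e i a).conjTranspose * (Matrix.of fun a i => e i a) = 1 := by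
    ext i j
    rw [hgram, e.inner_eq_ite, Matrix.one_apply]
  refine ⟨Matrix.of fun a i => e i a, hV, mul_eq_one_comm.1 hV, ?_⟩
  have hgV : g * (Matrix.of fun a i => e i a) = Matrix.of fun a i => T (e i) a := by
    ext a i
    simp [hT, Matrix.mul_apply, Matrix.toLpLin_apply, Matrix.mulVec, dotProduct]
  ext i j
  rw [hgV, hgram, ← LinearMap.adjoint_inner_right, ← LinearMap.comp_apply, he,
    LinearMap.IsSymmetric.apply_eigenvectorBasis, inner_smul_right, ← he, e.inner_eq_ite,
    ← T.sq_singularValues_fin hd, Matrix.diagonal_apply]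
  split_ifs with h
  · subst h; simp
  · simp

/-- The projection to the orthogonal complement of u kills u and does not increase norms. -/
theorem norm_sub_lineProj_smul_add_le {H : Type*} [NormedAddCommGroup H] [InnerProductSpace ℂ H]
    {u : H} (hu : ‖u‖ = 1) (β : ℂ) (z : H) :
    ‖β • u + z - lineProj u (β • u + z)‖ ≤ ‖z‖ := by
  have h1 : β • u + z - lineProj u (β • u + z) = z - lineProj u z := by
    rw [map_add, map_smul, lineProj_apply u u, inner_self_eq_norm_sq_to_K, hu]
    simp
  rw [h1, ← sq_le_sq₀ (norm_nonneg _) (norm_nonneg _), lineProj_apply, @norm_sub_sq ℂ,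
    inner_smul_right, norm_smul, hu, ← inner_conj_symm z, RCLike.mul_conj]
  norm_cast
  nlinarith [sq_nonneg ‖(inner ℂ u z : ℂ)‖]

theorem isDominated_of_forall_exists {H : Type*} [NormedAddCommGroup H] [InnerProductSpace ℂ H]
    {T : H →L[ℂ] H} {x : H} {s ε : ℝ} (hs : 0 < s) (hε : 0 ≤ ε) (hT : ∀ y, ‖T y‖ ≤ s * ‖y‖)
    (hx : ‖x‖ = s⁻¹) (hTx : ‖T x‖ = 1)
    (h : ∀ w, ∃ (β : ℂ) (z : H), T w = β • T x + z ∧ ‖z‖ ≤ ε * s * ‖w‖) :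
    IsDominated T (T x) ε := by
  have hTs : ‖T‖ ≤ s := ContinuousLinearMap.opNorm_le_bound _ hs.le hT
  have hsT : s ≤ ‖T‖ := by
    have := T.le_opNorm x
    rw [hTx, hx, ← div_eq_mul_inv, le_div_iff₀ hs, one_mul] at this
    exact this
  refine ⟨hTx, ⟨x, rfl, ?_⟩, fun w => ?_⟩
  · rw [hx, ← div_eq_mul_inv]
    exact div_le_one_of_le₀ hTs hs.le
  · obtain ⟨β, z, hw, hz⟩ := h w
    rw [hw]
    refine (norm_sub_lineProj_smul_add_le hTx β z).trans (hz.trans ?_)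
    gcongr

set_option maxHeartbeats 1000000 in
/-- The action on antisymmetric `k + 1`-tensors is dominated, with the ratio of consecutive
singular values as relative error. -/
theorem exists_isDominated_antisymAction {d k : ℕ} (hk : k + 1 ≤ d)
    (g : Matrix (Fin d) (Fin d) ℂ) (hg : ∀ m < d, 0 < (Matrix.toEuclideanLin g).singularValues m) :
    ∃ u, IsDominated (H := antisymTensor (k + 1) (Fin d)) (antisymAction (k + 1) g) u
      ((Matrix.toEuclideanLin g).singularValues (k + 1) /
        (Matrix.toEuclideanLin g).singularValues k) := by
  set σ : ℕ → ℝ := fun m => (Matrix.toEuclideanLin g).singularValues m with hσdef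
  have hσ : Antitone σ := (Matrix.toEuclideanLin g).singularValues_antitone
  have h0 (m) : 0 ≤ σ m := (Matrix.toEuclideanLin g).singularValues_nonneg m
  obtain ⟨V, hV1, hV2, hV⟩ := exists_unitary_gram_eq_diagonal g
  -- After precomposition with the unitary V, the Gram matrix of the tensor power is diagonal with
  -- entries `c i ^ 2`; the norm becomes a weighted sum over coordinates.
  set c : (Fin (k + 1) → Fin d) → ℝ := fun i => ∏ a, σ (i a) with hc
  have hc0 (i) : 0 ≤ c i := Finset.prod_nonneg fun a _ => h0 _
  have hnorm (y : antisymTensor (k + 1) (Fin d)) :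
      ‖antisymAction (k + 1) (g * V) y‖ ^ 2 = ∑ i, c i ^ 2 * ‖y.1 i‖ ^ 2 := by
    rw [Submodule.coe_norm, coe_antisymAction]
    refine norm_sq_toEuclideanCLM_of_gram ?_ _
    rw [← tensorPow_conjTranspose, ← tensorPow_mul, hV, tensorPow_diagonal]
    congr 1
    ext i
    simp [hc, Finset.prod_pow, σ]
  have hisom (y : antisymTensor (k + 1) (Fin d)) : ‖antisymAction (k + 1) V y‖ = ‖y‖ := by
    rw [← sq_eq_sq₀ (norm_nonneg _) (norm_nonneg _), Submodule.coe_norm, Submodule.coe_norm,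
      coe_antisymAction, norm_sq_toEuclideanCLM_of_gram (c := fun _ => 1),
      EuclideanSpace.norm_sq_eq]
    · simp
    · rw [← tensorPow_conjTranspose, ← tensorPow_mul, hV1, tensorPow_one]
      simp
  have hsurj (x : antisymTensor (k + 1) (Fin d)) :
      antisymAction (k + 1) V (antisymAction (k + 1) V.conjTranspose x) = x := by
    rw [← mul_apply_eq_comp, ← antisymAction_mul, hV2, antisymAction_one, one_apply_eq_self]
  have hcomp (y : antisymTensor (k + 1) (Fin d)) :
      antisymAction (k + 1) g (antisymAction (k + 1) V y) = antisymAction (k + 1) (g * V) y := by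
    rw [antisymAction_mul, mul_apply_eq_comp]
  set s : ℝ := ∏ m ∈ Finset.range (k + 1), σ m with hs
  have hs0 : 0 < s := Finset.prod_pos fun m hm => hg m (by rw [Finset.mem_range] at hm; omega)
  have hσk : 0 < σ k := hg k (by omega)
  set T := antisymAction (k + 1) g with hT
  have hcs (y : antisymTensor (k + 1) (Fin d)) : ‖antisymAction (k + 1) (g * V) y‖ ≤ s * ‖y‖ := by
    rw [← sq_le_sq₀ (norm_nonneg _) (by positivity), hnorm, mul_pow, Submodule.coe_norm,
      EuclideanSpace.norm_sq_eq, Finset.mul_sum]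
    refine Finset.sum_le_sum fun i _ => ?_
    by_cases hi : Function.Injective i
    · gcongr
      · exact hc0 i
      · exact prod_comp_le hσ h0 hi
    · simp [apply_eq_zero_of_not_injective y.2 hi]
  have hTs (x : antisymTensor (k + 1) (Fin d)) : ‖T x‖ ≤ s * ‖x‖ := by
    rw [← hsurj x, hcomp, hisom]
    exact hcs _
  have hι : Function.Injective (Fin.castLE hk) := Fin.castLE_injective hk
  -- The tensor on the first k + 1 indices, on which the largest weight s is attained.
  set u₀ : antisymTensor (k + 1) (Fin d) :=
    ⟨antisymBasis (Fin.castLE hk), antisymBasis_mem _⟩ with hu₀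
  have hu₀0 : 0 < ‖u₀‖ := by
    refine norm_pos_iff.2 fun h => ?_
    have h1 := congrArg (fun z : antisymTensor (k + 1) (Fin d) => z.1 (Fin.castLE hk)) h
    have h2 := antisymBasis_comp hι 1
    simp only [Equiv.Perm.coe_one, Function.comp_id] at h2
    simp [hu₀, h2] at h1
  have hu₀n : ‖antisymAction (k + 1) (g * V) u₀‖ = s * ‖u₀‖ := by
    rw [← sq_eq_sq₀ (norm_nonneg _) (by positivity), hnorm, mul_pow, Submodule.coe_norm,
      EuclideanSpace.norm_sq_eq, Finset.mul_sum]
    refine Finset.sum_congr rfl fun i _ => ?_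
    by_cases hi : ∃ τ : Equiv.Perm (Fin (k + 1)), i = Fin.castLE hk ∘ τ
    · obtain ⟨τ, rfl⟩ := hi
      congr 2
      simp only [hc, Function.comp]
      rw [Equiv.prod_comp τ fun a => σ (Fin.castLE hk a), hs, Finset.prod_range]
      rfl
    · push Not at hi
      simp [hu₀, antisymBasis_eq_zero hi]
  set x : antisymTensor (k + 1) (Fin d) :=
    (((s * ‖u₀‖)⁻¹ : ℝ) : ℂ) • antisymAction (k + 1) V u₀ with hx
  have hxn : ‖x‖ = s⁻¹ := by
    rw [hx, norm_smul, hisom, Complex.norm_real, Real.norm_of_nonneg (by positivity)]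
    field_simp
  have hTx : T x = (((s * ‖u₀‖)⁻¹ : ℝ) : ℂ) • antisymAction (k + 1) (g * V) u₀ := by
    rw [hx, map_smul, hcomp]
  have hTxn : ‖T x‖ = 1 := by
    rw [hTx, norm_smul, hu₀n, Complex.norm_real, Real.norm_of_nonneg (by positivity)]
    field_simp
  refine ⟨T x, isDominated_of_forall_exists hs0 (div_nonneg (h0 _) (h0 _)) hTs hxn hTxn
    fun w => ?_⟩
  set y := antisymAction (k + 1) V.conjTranspose w with hy
  have hyw : antisymAction (k + 1) V y = w := hsurj w
  have hyn : ‖y‖ = ‖w‖ := by rw [← hyw, hisom]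
  set α : ℂ := y.1 (Fin.castLE hk) with hα
  -- Antisymmetry makes y' vanish at every reordering of the first k + 1 indices. All other
  -- injective indices have weight at most `σ (k + 1) / σ k * s`.
  set y' := y - α • u₀ with hy'
  have hy'0 (τ : Equiv.Perm (Fin (k + 1))) : y'.1 (Fin.castLE hk ∘ τ) = 0 := by
    simp only [hy', hu₀, Submodule.coe_sub, Submodule.coe_smul, PiLp.sub_apply, PiLp.smul_apply,
      antisymBasis_comp hι, smul_eq_mul, y.2 τ (Fin.castLE hk), hα]
    ring
  have hy'1 {i : Fin (k + 1) → Fin d}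
      (hi : ∀ τ : Equiv.Perm (Fin (k + 1)), i ≠ Fin.castLE hk ∘ τ) : y'.1 i = y.1 i := by
    simp [hy', hu₀, antisymBasis_eq_zero hi]
  have hsmall : ‖antisymAction (k + 1) (g * V) y'‖ ≤ σ (k + 1) / σ k * s * ‖y‖ := by
    have hs' : σ (k + 1) / σ k * s = (∏ m ∈ Finset.range k, σ m) * σ (k + 1) := by
      rw [hs, Finset.prod_range_succ]; field_simp
    have hr : 0 ≤ σ (k + 1) / σ k * s := mul_nonneg (div_nonneg (h0 _) (h0 _)) hs0.le
    rw [← sq_le_sq₀ (norm_nonneg _) (by positivity), hnorm, mul_pow, Submodule.coe_norm y,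
      EuclideanSpace.norm_sq_eq, Finset.mul_sum]
    refine Finset.sum_le_sum fun i _ => ?_
    by_cases hi : ∃ τ : Equiv.Perm (Fin (k + 1)), i = Fin.castLE hk ∘ τ
    · obtain ⟨τ, rfl⟩ := hi
      rw [hy'0]
      simp only [norm_zero, ne_eq, OfNat.ofNat_ne_zero, not_false_eq_true, zero_pow, mul_zero]
      positivity
    · push Not at hi
      rw [hy'1 hi]
      by_cases hinj : Function.Injective i
      · gcongr
        · exact hc0 i
        · rw [hs']
          exact prod_comp_le_of_ne hσ h0 hk hinj hi
      · simp [apply_eq_zero_of_not_injective y.2 hinj]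
  have hTw : T w = (α * ((s * ‖u₀‖ : ℝ) : ℂ)) • T x + antisymAction (k + 1) (g * V) y' := by
    rw [hTx, smul_smul, mul_assoc, ← Complex.ofReal_mul, mul_inv_cancel₀ (by positivity),
      Complex.ofReal_one, mul_one, ← map_smul, ← map_add, hy', add_sub_cancel, ← hcomp, hyw]
  exact ⟨_, _, hTw, hyn ▸ hsmall⟩

end SingularValues

/-! ### The wedge pairing as an invariant continuous form. -/

section WedgeForm

variable {n : Type*} [Fintype n] {k : ℕ}

/-- The exterior product on antisymmetric tensors as a continuous bilinear form. -/
noncomputable def antisymForm (e : Fin k ⊕ Fin k ≃ n) :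
    antisymTensor k n →L[ℂ] antisymTensor k n →L[ℂ] ℂ :=
  LinearMap.toContinuousLinearMap ((LinearMap.toContinuousLinearMap :
    (antisymTensor k n →ₗ[ℂ] ℂ) ≃ₗ[ℂ] (antisymTensor k n →L[ℂ] ℂ)).toLinearMap ∘ₗ
      LinearMap.mk₂ ℂ (fun x y => wedgeForm e x.1 y.1)
        (fun x x' y => by
          simp only [wedgeForm, Submodule.coe_add, PiLp.add_apply, ← Finset.sum_add_distrib]
          exact Finset.sum_congr rfl fun π _ => by ring)
        (fun c x y => by
          simp only [wedgeForm, Submodule.coe_smul, PiLp.smul_apply, smul_eq_mul, Finset.mul_sum]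
          exact Finset.sum_congr rfl fun π _ => by ring)
        (fun x y y' => by
          simp only [wedgeForm, Submodule.coe_add, PiLp.add_apply, ← Finset.sum_add_distrib]
          exact Finset.sum_congr rfl fun π _ => by ring)
        (fun c x y => by
          simp only [wedgeForm, Submodule.coe_smul, PiLp.smul_apply, smul_eq_mul, Finset.mul_sum]
          exact Finset.sum_congr rfl fun π _ => by ring))

theorem antisymForm_apply (e : Fin k ⊕ Fin k ≃ n) (x y : antisymTensor k n) :
    antisymForm e x y = wedgeForm e x.1 y.1 := rfl

theorem antisymForm_antisymAction [DecidableEq n] (e : Fin k ⊕ Fin k ≃ n) {g : Matrix n n ℂ}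
    (hg : g.det = 1) (x y : antisymTensor k n) :
    antisymForm e (antisymAction k g x) (antisymAction k g y) = antisymForm e x y := by
  rw [antisymForm_apply, coe_antisymAction, coe_antisymAction, wedgeForm_invariant, hg, one_mul,
    antisymForm_apply]

theorem exists_mul_norm_le_norm_of_nondegenerate {H : Type*} [NormedAddCommGroup H]
    [NormedSpace ℂ H] [FiniteDimensional ℂ H] (ω : H →L[ℂ] H →L[ℂ] ℂ)
    (h : ∀ w, w ≠ 0 → ∃ x, ω w x ≠ 0) : ∃ b : ℝ, 0 < b ∧ ∀ w, b * ‖w‖ ≤ ‖ω w‖ := by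
  have hker : LinearMap.ker ω.toLinearMap = ⊥ := by
    rw [LinearMap.ker_eq_bot']
    intro w hw
    by_contra h0
    obtain ⟨x, hx⟩ := h w h0
    exact hx (DFunLike.congr_fun hw x)
  obtain ⟨K, hK, hanti⟩ := ω.toLinearMap.exists_antilipschitzWith hker
  refine ⟨(K : ℝ)⁻¹, by positivity, fun w => ?_⟩
  rw [inv_mul_le_iff₀ (by positivity)]
  exact hanti.le_mul_norm (map_zero _) w

theorem exists_antisymForm_ne_zero (hk : Odd k) (e : Fin k ⊕ Fin k ≃ n) (w : antisymTensor k n)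
    (h0 : w ≠ 0) : ∃ x, antisymForm e w x ≠ 0 := by
  obtain ⟨x, hx, hne⟩ := exists_wedgeForm_ne_zero e w.2 fun h => h0 (Subtype.ext h)
  refine ⟨⟨x, hx⟩, ?_⟩
  rwa [antisymForm_apply, wedgeForm_skew hk, neg_ne_zero]

end WedgeForm

/-! ### From Anosov representations to dominated ones; conclusion. -/

theorem singularValues_pos_of_det_ne_zero {d : ℕ} {g : Matrix (Fin d) (Fin d) ℂ} (hg : g.det ≠ 0)
    (m : ℕ) (hm : m < d) : 0 < (Matrix.toEuclideanLin g).singularValues m := by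
  refine (Matrix.toEuclideanLin g).injective_iff_forall_lt_finrank_singularValues_pos.1 ?_ m
    (by simpa using hm)
  rw [← LinearMap.ker_eq_bot, LinearMap.ker_eq_bot']
  intro x hx
  have h1 : g.mulVec x.ofLp = 0 := by
    have := congrArg WithLp.ofLp hx
    simpa using this
  have h2 := Matrix.eq_zero_of_mulVec_eq_zero hg h1
  ext i
  simpa using congrFun h2 i

/-- The representation on antisymmetric tensors induced by a representation in `SL_d(ℂ)`. -/
noncomputable def antisymRep {Γ : Type*} [Group Γ] (k : ℕ) {d : ℕ}
    (ρ : Γ →* Matrix.SpecialLinearGroup (Fin d) ℂ) :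
    Γ →* (antisymTensor k (Fin d) →L[ℂ] antisymTensor k (Fin d)) where
  toFun γ := antisymAction k (ρ γ).1
  map_one' := by
    rw [map_one]
    exact antisymAction_one
  map_mul' a b := by
    rw [map_mul, Matrix.SpecialLinearGroup.coe_mul]
    exact antisymAction_mul _ _

theorem antisymRep_apply {Γ : Type*} [Group Γ] (k : ℕ) {d : ℕ}
    (ρ : Γ →* Matrix.SpecialLinearGroup (Fin d) ℂ) (γ : Γ) :
    antisymRep k ρ γ = antisymAction k (ρ γ).1 := rfl

theorem not_isAnosov_of_odd {Γ : Type*} [Group Γ] {S : Set Γ} (hΓ : IsWordHyperbolic S)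
    (hS2 : ProperlyContainsTwoSphere (GromovBoundary S)) {k d : ℕ} (hk : Odd (k + 1))
    (e : Fin (k + 1) ⊕ Fin (k + 1) ≃ Fin d) (ρ : Γ →* Matrix.SpecialLinearGroup (Fin d) ℂ) :
    ¬ IsAnosov S (k + 1) ρ := by
  rintro ⟨-, hkd, c, μ, hc, hμ, hgap⟩
  have hdet (γ : Γ) : (ρ γ).1.det = 1 := (ρ γ).2
  have hpos (γ : Γ) := singularValues_pos_of_det_ne_zero (g := (ρ γ).1) (by simp [hdet])
  choose u hu using fun γ => exists_isDominated_antisymAction (k := k) (by omega) (ρ γ).1 (hpos γ)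
  have hu' (γ : Γ) := antisymRep_apply (k + 1) ρ γ ▸ hu γ
  -- Inverting the Anosov gap gives C = c⁻¹ and θ = e^{-μ}; `sigma` counts from 1, hence the indices
  -- k and k + 1 for a (k + 1)-Anosov representation.
  have hε (γ : Γ) : (Matrix.toEuclideanLin (ρ γ).1).singularValues (k + 1) /
      (Matrix.toEuclideanLin (ρ γ).1).singularValues k ≤
      c⁻¹ * Real.exp (-μ) ^ wordLength S γ := by
    have h := hgap γ
    simp only [sigma, Nat.add_sub_cancel] at h
    have h1 := hpos γ k (by omega)
    have h2 := hpos γ (k + 1) (by omega)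
    rw [← Real.exp_nat_mul, ← inv_div]
    have h3 : Real.exp (wordLength S γ * -μ) = (Real.exp (μ * wordLength S γ))⁻¹ := by
      rw [← Real.exp_neg]; congr 1; ring
    rw [h3, ← mul_inv]
    exact inv_anti₀ (by positivity) h
  obtain ⟨b, hb, hnd⟩ := exists_mul_norm_le_norm_of_nondegenerate (antisymForm e)
    (exists_antisymForm_ne_zero hk e)
  have hω (γ : Γ) (x y : antisymTensor (k + 1) (Fin d)) :
      antisymForm e (antisymRep (k + 1) ρ γ x) (antisymRep (k + 1) ρ γ y) = antisymForm e x y :=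
    antisymForm_antisymAction e (hdet γ) x y
  have hskew (x y : antisymTensor (k + 1) (Fin d)) :
      antisymForm e x y = -antisymForm e y x := wedgeForm_skew hk e x.1 y.1
  have hθ : Real.exp (-μ) < 1 := by simpa using hμ
  have hc' : 0 ≤ c⁻¹ := by positivity
  exact not_properlyContainsTwoSphere_of_alternating hΓ hu' hc' (Real.exp_pos _) hθ hε hω hskew hb
    hnd hS2

theorem corollary1p4 {Γ : Type*} [Group Γ] (S : Set Γ) (hΓ : IsWordHyperbolic S)
    (hS2 : ProperlyContainsTwoSphere (GromovBoundary S)) (q : ℕ) :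
    ¬ ∃ ρ : Γ →* Matrix.SpecialLinearGroup (Fin (4 * q + 2)) ℂ, IsAnosov S (2 * q + 1) ρ := by
  rintro ⟨ρ, hρ⟩
  exact not_isAnosov_of_odd hΓ hS2 (odd_two_mul_add_one q)
    (finSumFinEquiv.trans (finCongr (by omega))) ρ hρ
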